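/- Let $\Omega=(0,a)\times(0,b)$ be a rectangle that can be divided into $n_x\times n_y$ square cells of side $h$ (so $n_xh=a$, $n_yh=b$, $h>0$, $n_x,n_y\ge 1$) for some $n_x,n_y,h$. Each such division is called a grid of $\Omega$. On a grid use the staggered (MAC) discretization of the steady Stokes equations with viscosity $1$ and no-slip walls: pressures $p_{i,j}$ at cell centers, velocity components $u_{i+1/2,j}$ and $v_{i,j+1/2}$ at the interior faces, zero normal velocity on the wall faces, and $$(D(u,v))_{i,j}=\frac{u_{i+1/2,j}-u_{i-1/2,j}}{h}+\frac{v_{i,j+1/2}-v_{i,j-1/2}}{h},$$ $$(Gp)^x_{i-1/2,j}=\frac{p_{i,j}-p_{i-1,j}}{h},\qquad (Gp)^y_{i,j-1/2}=\frac{p_{i,j}-p_{i,j-1}}{h}.$$ Let $L(u,v)=(L^xu,L^yv)$, where $L^x,L^y$ are the five-point Laplacians at the interior faces, in which the tangential difference quotient across a wall is the one-sided quotient over distance $h/2$ with wall value $0$ (equivalently, the ghost value is minus the adjacent interior value). Let $S=DL^{-1}G$. With $(p,q)=h^2\sum_{i,j}p_{i,j}q_{i,j}$, $\|q\|^2=(q,q)$,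 and $|w|_1^2=(-Lw,w)=-h^2\,w\cdot Lw$ for velocities $w$, define the inf-sup constant $$\eta=\inf_{\text{grids of }\Omega}\ \inf_{q\ne 0,\ \sum q_{i,j}=0}\ \sup_{w\ne 0}\ \frac{(q,Dw)}{\|q\|\,|w|_1},$$ which depends only on $\Omega$ and not on the grid. Then $\eta>0$, and for every grid of $\Omega$ the matrix $L$ is invertible and: 1. every eigenvalue (a priori complex) of $S$ is real and lies in $\{0\}\cup[\eta^2,1]$; 2. the eigenvalue $0$ of $S$ has algebraic multiplicity $1$; 3. if the grid has at least two cells, then at most $2(n_x-1)+2(n_y-1)$ eigenvalues of $S$, counted with algebraic multiplicity, differ from $1$. -/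

import Mathlib

open scoped Kronecker

noncomputable section

namespace MAC

/-!
Staggered (MAC) discretization, with square cells of side `h`, of the rectangle
`(0, nx * h) × (0, ny * h)` with velocity zero on all four walls.

In each direction with `n` cells, cell `i : Fin n` has centre `(i + 1/2) * h`, and the interior
face `k : Fin (n - 1)`, which separates cells `k` and `k + 1`, is at `(k + 1) * h`; the two
remaining faces lie on the walls, where the normal velocity vanishes.
-/

/-- Cells: the pressure unknowns. -/
abbrev Cell (nx ny : ℕ) := Fin nx × Fin ny

/-- Interior faces: the unknowns `u` (first summand, faces normal to `x`) and
`v` (second summand, faces normal to `y`). -/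
abbrev Face (nx ny : ℕ) := (Fin (nx - 1) × Fin ny) ⊕ (Fin nx × Fin (ny - 1))

/-- One-dimensional difference from cells to interior faces: `(p (k + 1) - p k) / h`. -/
def cellToFace (n : ℕ) (h : ℝ) : Matrix (Fin (n - 1)) (Fin n) ℝ :=
  Matrix.of fun k i =>
    if i.val = k.val + 1 then h⁻¹ else if i.val = k.val then -h⁻¹ else 0

/-- One-dimensional difference from faces to cells, `(u_{i + 1/2} - u_{i - 1/2}) / h`, the values
on the wall faces being zero. -/
def faceToCell (n : ℕ) (h : ℝ) : Matrix (Fin n) (Fin (n - 1)) ℝ :=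
  Matrix.of fun i k =>
    if k.val = i.val then h⁻¹ else if k.val + 1 = i.val then -h⁻¹ else 0

/-- One-dimensional second difference in the direction normal to the faces,
`(u (k - 1) - 2 * u k + u (k + 1)) / h ^ 2`, the values on the wall faces being zero. -/
def lapNormal (n : ℕ) (h : ℝ) : Matrix (Fin (n - 1)) (Fin (n - 1)) ℝ :=
  Matrix.of fun k l =>
    (h ^ 2)⁻¹ * (if k = l then -2
      else if k.val + 1 = l.val ∨ l.val + 1 = k.val then 1 else 0)

/-- One-dimensional second difference in the direction tangential to the faces. The flux at
distance `h / 2` from a wall is the one-sided difference quotient `(u - 0) / (h / 2)` with the wall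
value zero (equivalently, the ghost value is `-u`), so that the diagonal coefficient `-2` is
decreased by one for each neighbouring wall. -/
def lapTangential (n : ℕ) (h : ℝ) : Matrix (Fin n) (Fin n) ℝ :=
  Matrix.of fun i j =>
    (h ^ 2)⁻¹ * (if i = j then
        -2 - (if i.val = 0 then 1 else 0) - (if i.val + 1 = n then 1 else 0)
      else if i.val + 1 = j.val ∨ j.val + 1 = i.val then 1 else 0)

/-- The discrete gradient `G p = (Gˣ p, Gʸ p)`. -/
def grad (nx ny : ℕ) (h : ℝ) : Matrix (Face nx ny) (Cell nx ny) ℝ :=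
  Matrix.fromRows
    (cellToFace nx h ⊗ₖ (1 : Matrix (Fin ny) (Fin ny) ℝ))
    ((1 : Matrix (Fin nx) (Fin nx) ℝ) ⊗ₖ cellToFace ny h)

/-- The discrete divergence `D (u, v) = Dˣ u + Dʸ v`. -/
def div (nx ny : ℕ) (h : ℝ) : Matrix (Cell nx ny) (Face nx ny) ℝ :=
  Matrix.fromCols
    (faceToCell nx h ⊗ₖ (1 : Matrix (Fin ny) (Fin ny) ℝ))
    ((1 : Matrix (Fin nx) (Fin nx) ℝ) ⊗ₖ faceToCell ny h)

/-- The discrete vector Laplacian `L (u, v) = (Lˣ u, Lʸ v)` with no-slip walls. -/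
def lap (nx ny : ℕ) (h : ℝ) : Matrix (Face nx ny) (Face nx ny) ℝ :=
  Matrix.fromBlocks
    (lapNormal nx h ⊗ₖ (1 : Matrix (Fin ny) (Fin ny) ℝ)
      + (1 : Matrix (Fin (nx - 1)) (Fin (nx - 1)) ℝ) ⊗ₖ lapTangential ny h)
    0 0
    (lapTangential nx h ⊗ₖ (1 : Matrix (Fin (ny - 1)) (Fin (ny - 1)) ℝ)
      + (1 : Matrix (Fin nx) (Fin nx) ℝ) ⊗ₖ lapNormal ny h)

/-- The Schur complement `S = D L⁻¹ G`. -/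
def schur (nx ny : ℕ) (h : ℝ) : Matrix (Cell nx ny) (Cell nx ny) ℝ :=
  div nx ny h * (lap nx ny h)⁻¹ * grad nx ny h

/-- The Schur complement as a complex matrix, so that all its eigenvalues are considered. -/
def schurC (nx ny : ℕ) (h : ℝ) : Matrix (Cell nx ny) (Cell nx ny) ℂ :=
  (schur nx ny h).map (fun x : ℝ => (x : ℂ))

/-- `nx × ny` square cells of side `h` form a grid of the rectangle `(0, a) × (0, b)`. -/
def IsGrid (a b : ℝ) (nx ny : ℕ) (h : ℝ) : Prop :=
  0 < nx ∧ 0 < ny ∧ 0 < h ∧ nx * h = a ∧ ny * h = b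

/-- `(q, D w) / (‖q‖ * |w|₁)`, where `(p, q) = h² ∑ p q` is the discrete `L²` inner product,
`‖q‖² = (q, q)` and `|w|₁² = (-L w, w)` is the squared discrete `H¹₀` norm. -/
def infSupQuotient (nx ny : ℕ) (h : ℝ) (q : Cell nx ny → ℝ) (w : Face nx ny → ℝ) : ℝ :=
  (h ^ 2 * (q ⬝ᵥ (div nx ny h).mulVec w)) /
    (√(h ^ 2 * (q ⬝ᵥ q)) * √(h ^ 2 * (-(w ⬝ᵥ (lap nx ny h).mulVec w))))

/-- The inf-sup constant of the discretization on the rectangle `(0, a) × (0, b)`: the infimum,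
over all its grids and all nonzero pressures `q` of mean zero, of the supremum of
`(q, D w) / (‖q‖ * |w|₁)` over all nonzero velocities `w`. -/
def infSup (a b : ℝ) : ℝ :=
  sInf {r : ℝ | ∃ (nx ny : ℕ) (h : ℝ), IsGrid a b nx ny h ∧
    ∃ q : Cell nx ny → ℝ, q ≠ 0 ∧ ∑ c, q c = 0 ∧
      r = ⨆ w : {w : Face nx ny → ℝ // w ≠ 0}, infSupQuotient nx ny h q w}

end MAC

end

namespace MAC
open Matrix Finset

section

/-! ### One-dimensional difference matrices -/

/-! Write `D`, `G = -Dᵀ` for divergence and gradient and `C` for the discrete curl. Then `-L = DᵀD +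
CᵀC + 2h⁻²W`, with `W ≥ 0` diagonal and supported on faces that run along a wall (`neg_lap_eq`).
Hence `S = D(-L)⁻¹Dᵀ` is symmetric, and the energy `E(w) = -w·Lw` dominates `|Dw|²`. If `Sq = μq`
and `Lz = Gq`, then `Dz = μq` and `E(z) = μ|q|²`, so `μ²|q|² ≤ μ|q|²` and `0 ≤ μ ≤ 1`
(`eigenvalue_mem`). Cauchy–Schwarz in the energy bounds every inf-sup quotient of `q` by `√μ`
(`eigenvalue_bound`); for `μ ≠ 0` the vector `q` has mean zero, so `η² ≤ μ`. The kernel of `S` is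
that of `G`, the constants. If `p` vanishes on the cells touching a wall, then `Gp` is annihilated
by `C` and `W`, so `LGp = GDGp` and `S` fixes `DGp`; this provides `(nx-2)(ny-2)` dimensions of
eigenvalue 1.

The hard part is `η > 0`: `D` needs a right inverse bounded uniformly in the grid
(`exists_right_inverse`). The pressure is extended by zero to a rectangle 11 times larger in each
direction, where the gradient of a Neumann potential is a free-slip velocity with divergence `q` and
with sum of squared differences exactly `|q|²`. To the left and right of the original rectangle this
velocity is divergence-free and so has a stream function. Its values there are extended inwards with
control of second differences, and the rotated gradient of the extension is subtracted. The
divergence is unchanged and the velocity now vanishes at and beyond these walls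
(`exists_correction_x`). The same in the other direction gives no-slip on all walls
(`exists_correction_y`); there the mean-zero condition makes the new stream function vanish along
the walls already treated. Constants depend only on the aspect ratio, which all grids of a rectangle
share. -/

lemma faceToCell_eq (n : ℕ) (h : ℝ) : faceToCell n h = -(cellToFace n h)ᵀ := by
  ext i k
  rw [Matrix.neg_apply, transpose_apply]
  simp only [faceToCell, cellToFace, of_apply]
  split_ifs <;> first | omega | simp

lemma sum_cellToFace (n : ℕ) (h : ℝ) (k : Fin (n - 1)) (g : Fin n → ℝ) :
    ∑ i, cellToFace n h k i * g i
      = h⁻¹ * (g ⟨k + 1, by omega⟩ - g ⟨k, by omega⟩) := by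
  have hne : (⟨k + 1, by omega⟩ : Fin n) ≠ ⟨k, by omega⟩ := by simp [Fin.ext_iff]
  rw [Fintype.sum_eq_add _ _ hne]
  · simp [cellToFace]; ring
  · rintro i ⟨h1, h2⟩
    simp only [ne_eq, Fin.ext_iff] at h1 h2
    simp [cellToFace, h1, h2]

lemma sum_faceToCell (n : ℕ) (h : ℝ) (i : Fin n) (g : Fin (n - 1) → ℝ) :
    ∑ k, faceToCell n h i k * g k
      = h⁻¹ * ((if hi : i.val < n - 1 then g ⟨i, hi⟩ else 0)
          - (if hi : 0 < i.val then g ⟨i - 1, by omega⟩ else 0)) := by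
  have key : ∀ k, faceToCell n h i k * g k
      = (if k.val = i.val then h⁻¹ * g k else 0) - (if k.val + 1 = i.val then h⁻¹ * g k else 0) := by
    intro k
    simp only [faceToCell, of_apply]
    split_ifs <;> first | omega | ring
  rw [Finset.sum_congr rfl fun k _ => key k, Finset.sum_sub_distrib, mul_sub]
  congr 1
  · split_ifs with hi
    · rw [Fintype.sum_eq_single (⟨i, hi⟩ : Fin (n - 1))]
      · simp
      · intro k hk
        rw [if_neg]
        simpa [Fin.ext_iff] using hk
    · rw [mul_zero]
      exact Finset.sum_eq_zero fun k _ => if_neg (by omega)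
  · split_ifs with hi
    · rw [Fintype.sum_eq_single (⟨i - 1, by omega⟩ : Fin (n - 1))]
      · rw [if_pos]; simp only; omega
      · intro k hk
        rw [if_neg]
        simp only [ne_eq, Fin.ext_iff] at hk
        omega
    · rw [mul_zero]
      exact Finset.sum_eq_zero fun k _ => if_neg (by omega)

/-- The number of walls next to a cell, on the diagonal. -/
noncomputable def wallCount (n : ℕ) : Matrix (Fin n) (Fin n) ℝ :=
  diagonal fun i => (if i.val = 0 then 1 else 0) + (if i.val + 1 = n then 1 else 0)

lemma lapNormal_eq (n : ℕ) (h : ℝ) : lapNormal n h = cellToFace n h * faceToCell n h := by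
  ext k l
  rw [mul_apply, sum_cellToFace]
  simp only [lapNormal, faceToCell, of_apply, Fin.ext_iff, pow_two, mul_inv]
  split_ifs <;> first | omega | ring

/-- The composition of differences is the Neumann second difference; a no-slip wall at distance `h /
2` adds a penalty of `2 / h²` per wall. -/
lemma lapTangential_eq (n : ℕ) (h : ℝ) :
    lapTangential n h = faceToCell n h * cellToFace n h - (2 * (h ^ 2)⁻¹) • wallCount n := by
  ext i j
  rw [Matrix.sub_apply, Matrix.smul_apply, mul_apply, sum_faceToCell]
  simp only [lapTangential, cellToFace, wallCount, of_apply, diagonal_apply, Fin.ext_iff,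
    pow_two, mul_inv, smul_eq_mul]
  have := i.2
  have := j.2
  split_ifs <;> first | omega | ring

/-! ### The two-dimensional operators -/

variable (nx ny : ℕ) (h : ℝ)

/-- The discrete curl `u_y - v_x` at the interior nodes. -/
noncomputable def curl : Matrix (Fin (nx - 1) × Fin (ny - 1)) (Face nx ny) ℝ :=
  fromCols ((1 : Matrix (Fin (nx - 1)) (Fin (nx - 1)) ℝ) ⊗ₖ cellToFace ny h)
    (-(cellToFace nx h ⊗ₖ (1 : Matrix (Fin (ny - 1)) (Fin (ny - 1)) ℝ)))

/-- The number of walls to which a face is adjacent tangentially, on the diagonal. -/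
noncomputable def wall : Matrix (Face nx ny) (Face nx ny) ℝ :=
  fromBlocks ((1 : Matrix (Fin (nx - 1)) (Fin (nx - 1)) ℝ) ⊗ₖ wallCount ny) 0 0
    (wallCount nx ⊗ₖ (1 : Matrix (Fin (ny - 1)) (Fin (ny - 1)) ℝ))

lemma sub_kronecker' {l m n p : Type*} (A B : Matrix l m ℝ) (C : Matrix n p ℝ) :
    (A - B) ⊗ₖ C = A ⊗ₖ C - B ⊗ₖ C := by
  ext; simp [sub_mul]

lemma kronecker_sub' {l m n p : Type*} (C : Matrix l m ℝ) (A B : Matrix n p ℝ) :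
    C ⊗ₖ (A - B) = C ⊗ₖ A - C ⊗ₖ B := by
  ext; simp [mul_sub]

lemma kronecker_transpose {l m n p : Type*} (A : Matrix l m ℝ) (B : Matrix n p ℝ) :
    (A ⊗ₖ B)ᵀ = Aᵀ ⊗ₖ Bᵀ := by
  ext; simp

lemma neg_kronecker' {l m n p : Type*} (A : Matrix l m ℝ) (B : Matrix n p ℝ) :
    (-A) ⊗ₖ B = -(A ⊗ₖ B) := by
  ext; simp

lemma kronecker_neg' {l m n p : Type*} (A : Matrix l m ℝ) (B : Matrix n p ℝ) :
    A ⊗ₖ (-B) = -(A ⊗ₖ B) := by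
  ext; simp

lemma grad_eq : grad nx ny h = -(div nx ny h)ᵀ := by
  simp only [grad, div, transpose_fromCols, kronecker_transpose, faceToCell_eq, transpose_neg,
    transpose_transpose, transpose_one, neg_kronecker', kronecker_neg', ← fromRows_neg, neg_neg]

lemma curl_mul_grad : curl nx ny h * grad nx ny h = 0 := by
  simp [curl, grad, fromCols_mul_fromRows, ← mul_kronecker_mul, Matrix.neg_mul]

/-- Differences in `x` commute with differences in `y`, so the off-diagonal blocks of `DᵀD` and
`CᵀC` cancel, while the diagonal blocks add up to the Neumann part of the Laplacian. -/
lemma neg_lap_eq : -lap nx ny h = (div nx ny h)ᵀ * div nx ny h + (curl nx ny h)ᵀ * curl nx ny h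
    + (2 * (h ^ 2)⁻¹) • wall nx ny := by
  have e : ∀ n, (cellToFace n h)ᵀ = -faceToCell n h := fun n => by rw [faceToCell_eq, neg_neg]
  have e' : ∀ n, (faceToCell n h)ᵀ = -cellToFace n h := fun n => by
    rw [faceToCell_eq, transpose_neg, transpose_transpose]
  simp only [lap, div, curl, wall, transpose_fromCols, fromRows_mul_fromCols, transpose_neg,
    kronecker_transpose, transpose_one, e, e', neg_kronecker', kronecker_neg', Matrix.neg_mul,
    Matrix.mul_neg, neg_neg, ← mul_kronecker_mul, Matrix.one_mul, Matrix.mul_one, lapNormal_eq,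
    lapTangential_eq, fromBlocks_smul, fromBlocks_add, fromBlocks_neg]
  congr 1
  · rw [kronecker_sub', kronecker_smul]; abel
  · simp
  · simp
  · rw [sub_kronecker', smul_kronecker]; abel

lemma dotProduct_transpose_mul_self {m n : Type*} [Fintype m] [Fintype n] (B : Matrix m n ℝ)
    (w : n → ℝ) : w ⬝ᵥ (Bᵀ * B) *ᵥ w = (B *ᵥ w) ⬝ᵥ (B *ᵥ w) := by
  rw [← mulVec_mulVec, dotProduct_mulVec, vecMul_transpose]

lemma wall_eq : wall nx ny = diagonal (Sum.elim
    (fun c : Fin (nx - 1) × Fin ny =>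
      (if c.2.val = 0 then 1 else 0) + (if c.2.val + 1 = ny then (1 : ℝ) else 0))
    (fun c : Fin nx × Fin (ny - 1) =>
      (if c.1.val = 0 then 1 else 0) + (if c.1.val + 1 = nx then (1 : ℝ) else 0))) := by
  rw [wall, wallCount, wallCount, ← diagonal_one, ← diagonal_one, diagonal_kronecker_diagonal,
    diagonal_kronecker_diagonal, fromBlocks_diagonal]
  simp

lemma wall_nonneg (w : Face nx ny → ℝ) : 0 ≤ w ⬝ᵥ wall nx ny *ᵥ w := by
  rw [wall_eq]
  refine Finset.sum_nonneg fun i _ => ?_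
  rw [mulVec_diagonal, mul_left_comm]
  refine mul_nonneg ?_ (mul_self_nonneg _)
  rcases i with c | c <;> simp only [Sum.elim_inl, Sum.elim_inr] <;> positivity

/-- The energy `-w ⬝ᵥ L w`. -/
lemma energy_eq (w : Face nx ny → ℝ) : -(w ⬝ᵥ lap nx ny h *ᵥ w)
    = (div nx ny h *ᵥ w) ⬝ᵥ (div nx ny h *ᵥ w) + (curl nx ny h *ᵥ w) ⬝ᵥ (curl nx ny h *ᵥ w)
      + 2 * (h ^ 2)⁻¹ * (w ⬝ᵥ wall nx ny *ᵥ w) := by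
  rw [← dotProduct_neg, ← neg_mulVec, neg_lap_eq, add_mulVec, add_mulVec, dotProduct_add,
    dotProduct_add, dotProduct_transpose_mul_self, dotProduct_transpose_mul_self, smul_mulVec,
    dotProduct_smul, smul_eq_mul]

lemma div_sq_le_energy (w : Face nx ny → ℝ) :
    (div nx ny h *ᵥ w) ⬝ᵥ (div nx ny h *ᵥ w) ≤ -(w ⬝ᵥ lap nx ny h *ᵥ w) := by
  rw [energy_eq]
  have h1 : 0 ≤ (curl nx ny h *ᵥ w) ⬝ᵥ (curl nx ny h *ᵥ w) :=
    Finset.sum_nonneg fun i _ => mul_self_nonneg _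
  have h2 := wall_nonneg nx ny w
  have : 0 ≤ 2 * (h ^ 2)⁻¹ * (w ⬝ᵥ wall nx ny *ᵥ w) := by positivity
  linarith

/-- The energy in terms of difference quotients. -/
lemma energy_eq_diff (w : Face nx ny → ℝ) : -(w ⬝ᵥ lap nx ny h *ᵥ w)
    = (∑ c, ((faceToCell nx h ⊗ₖ (1 : Matrix (Fin ny) (Fin ny) ℝ)) *ᵥ (w ∘ Sum.inl)) c ^ 2
      + ∑ c, (((1 : Matrix (Fin (nx - 1)) (Fin (nx - 1)) ℝ) ⊗ₖ cellToFace ny h)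
          *ᵥ (w ∘ Sum.inl)) c ^ 2)
      + (∑ c, ((cellToFace nx h ⊗ₖ (1 : Matrix (Fin (ny - 1)) (Fin (ny - 1)) ℝ))
          *ᵥ (w ∘ Sum.inr)) c ^ 2
      + ∑ c, (((1 : Matrix (Fin nx) (Fin nx) ℝ) ⊗ₖ faceToCell ny h) *ᵥ (w ∘ Sum.inr)) c ^ 2)
      + 2 * (h ^ 2)⁻¹ * (w ⬝ᵥ wall nx ny *ᵥ w) := by
  have e : ∀ n, (cellToFace n h)ᵀ = -faceToCell n h := fun n => by rw [faceToCell_eq, neg_neg]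
  have e' : ∀ n, (faceToCell n h)ᵀ = -cellToFace n h := fun n => by
    rw [faceToCell_eq, transpose_neg, transpose_transpose]
  have sq : ∀ {m n : Type} [Fintype m] [Fintype n] (B : Matrix m n ℝ) (x : n → ℝ),
      ∑ c, (B *ᵥ x) c ^ 2 = x ⬝ᵥ (Bᵀ * B) *ᵥ x := by
    intro m n _ _ B x
    rw [dotProduct_transpose_mul_self]
    simp [dotProduct, pow_two]
  have hsum : w = Sum.elim (w ∘ Sum.inl) (w ∘ Sum.inr) := by
    ext i; cases i <;> rfl
  have key : -lap nx ny h - (2 * (h ^ 2)⁻¹) • wall nx ny = fromBlocks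
      (((faceToCell nx h ⊗ₖ (1 : Matrix (Fin ny) (Fin ny) ℝ))ᵀ
        * (faceToCell nx h ⊗ₖ (1 : Matrix (Fin ny) (Fin ny) ℝ)))
        + (((1 : Matrix (Fin (nx - 1)) (Fin (nx - 1)) ℝ) ⊗ₖ cellToFace ny h)ᵀ
          * ((1 : Matrix (Fin (nx - 1)) (Fin (nx - 1)) ℝ) ⊗ₖ cellToFace ny h))) 0 0
      (((cellToFace nx h ⊗ₖ (1 : Matrix (Fin (ny - 1)) (Fin (ny - 1)) ℝ))ᵀ
        * (cellToFace nx h ⊗ₖ (1 : Matrix (Fin (ny - 1)) (Fin (ny - 1)) ℝ)))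
        + (((1 : Matrix (Fin nx) (Fin nx) ℝ) ⊗ₖ faceToCell ny h)ᵀ
          * ((1 : Matrix (Fin nx) (Fin nx) ℝ) ⊗ₖ faceToCell ny h))) := by
    rw [sub_eq_iff_eq_add]
    simp only [lap, wall, kronecker_transpose, transpose_one, e, e', neg_kronecker',
      kronecker_neg', Matrix.neg_mul, ← mul_kronecker_mul, Matrix.one_mul,
      lapNormal_eq, lapTangential_eq, fromBlocks_smul, fromBlocks_add, fromBlocks_neg]
    congr 1
    · rw [kronecker_sub', kronecker_smul]; abel
    · simp
    · simp
    · rw [sub_kronecker', smul_kronecker]; abel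
  rw [← dotProduct_neg, ← neg_mulVec, ← sub_add_cancel (-lap nx ny h) ((2 * (h ^ 2)⁻¹) • wall nx ny),
    key, add_mulVec, dotProduct_add, smul_mulVec, dotProduct_smul, smul_eq_mul]
  congr 1
  simp only [sq]
  conv_lhs => rw [hsum]
  rw [fromBlocks_mulVec, sumElim_dotProduct_sumElim]
  simp [Matrix.add_mulVec, dotProduct_add]

end


section

/-! ### The Schur complement -/

lemma kronecker_one_mulVec {l m n : Type*} [Fintype m] [Fintype n] [DecidableEq n]
    (A : Matrix l m ℝ) (x : m × n → ℝ) (i : l) (j : n) :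
    ((A ⊗ₖ (1 : Matrix n n ℝ)) *ᵥ x) (i, j) = ∑ k, A i k * x (k, j) := by
  simp [mulVec, dotProduct, Fintype.sum_prod_type, Matrix.one_apply]

lemma one_kronecker_mulVec {l m n : Type*} [Fintype m] [Fintype n] [DecidableEq n]
    (A : Matrix l m ℝ) (x : n × m → ℝ) (i : n) (j : l) :
    (((1 : Matrix n n ℝ) ⊗ₖ A) *ᵥ x) (i, j) = ∑ k, A j k * x (i, k) := by
  simp [mulVec, dotProduct, Fintype.sum_prod_type, Matrix.one_apply, Finset.sum_ite_eq,
    ite_mul]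

lemma eq_zero_of_sum_faceToCell {n : ℕ} {h : ℝ} (hh : h ≠ 0) (g : Fin (n - 1) → ℝ)
    (hg : ∀ i, ∑ k, faceToCell n h i k * g k = 0) (k : Fin (n - 1)) : g k = 0 := by
  obtain ⟨k, hk⟩ := k
  induction k with
  | zero =>
    have := hg ⟨0, by omega⟩
    rw [sum_faceToCell] at this
    simpa [hk, hh] using this
  | succ k ih =>
    have := hg ⟨k + 1, by omega⟩
    rw [sum_faceToCell] at this
    simpa [hk, hh, ih (by omega)] using this

/-! ### Definiteness of the energy and symmetry of the Schur complement -/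

variable {nx ny : ℕ} {h : ℝ}

lemma energy_nonneg (w : Face nx ny → ℝ) : 0 ≤ -(w ⬝ᵥ lap nx ny h *ᵥ w) :=
  le_trans (Finset.sum_nonneg fun _ _ => mul_self_nonneg _) (div_sq_le_energy nx ny h w)

lemma energy_pos (hh : h ≠ 0) {w : Face nx ny → ℝ} (hw : w ≠ 0) :
    0 < -(w ⬝ᵥ lap nx ny h *ᵥ w) := by
  refine lt_of_le_of_ne (energy_nonneg w) fun h0 => hw ?_
  rw [energy_eq_diff] at h0
  have hW : 0 ≤ 2 * (h ^ 2)⁻¹ * (w ⬝ᵥ wall nx ny *ᵥ w) := by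
    have := wall_nonneg nx ny w
    positivity
  have n1 : ∀ {ι : Type} [Fintype ι] (f : ι → ℝ), 0 ≤ ∑ c, f c ^ 2 := fun f =>
    Finset.sum_nonneg fun _ _ => sq_nonneg _
  have a1 := n1 ((faceToCell nx h ⊗ₖ (1 : Matrix (Fin ny) (Fin ny) ℝ)) *ᵥ (w ∘ Sum.inl))
  have a2 := n1 (((1 : Matrix (Fin (nx - 1)) (Fin (nx - 1)) ℝ) ⊗ₖ cellToFace ny h)
    *ᵥ (w ∘ Sum.inl))
  have a3 := n1 ((cellToFace nx h ⊗ₖ (1 : Matrix (Fin (ny - 1)) (Fin (ny - 1)) ℝ))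
    *ᵥ (w ∘ Sum.inr))
  have a4 := n1 (((1 : Matrix (Fin nx) (Fin nx) ℝ) ⊗ₖ faceToCell ny h) *ᵥ (w ∘ Sum.inr))
  have z1 : ∑ c, ((faceToCell nx h ⊗ₖ (1 : Matrix (Fin ny) (Fin ny) ℝ)) *ᵥ (w ∘ Sum.inl)) c ^ 2
    = 0 := by linarith
  have z4 : ∑ c, (((1 : Matrix (Fin nx) (Fin nx) ℝ) ⊗ₖ faceToCell ny h) *ᵥ (w ∘ Sum.inr)) c ^ 2
    = 0 := by linarith
  -- The differences normal to the faces include those against the zero values on the walls, so they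
  -- alone determine the velocity.
  rw [Finset.sum_eq_zero_iff_of_nonneg fun _ _ => sq_nonneg _] at z1 z4
  ext i
  rcases i with ⟨k, j⟩ | ⟨i, k⟩
  · refine eq_zero_of_sum_faceToCell hh (fun k => w (Sum.inl (k, j))) (fun i => ?_) k
    have := z1 (i, j) (Finset.mem_univ _)
    rw [kronecker_one_mulVec] at this
    simpa using this
  · refine eq_zero_of_sum_faceToCell hh (fun k => w (Sum.inr (i, k))) (fun j => ?_) k
    have := z4 (i, j) (Finset.mem_univ _)
    rw [one_kronecker_mulVec] at this
    simpa using this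

lemma lap_transpose : (lap nx ny h)ᵀ = lap nx ny h := by
  rw [← neg_inj, ← transpose_neg, neg_lap_eq]
  have : (wall nx ny)ᵀ = wall nx ny := by
    simp [wall, wallCount, fromBlocks_transpose, kronecker_transpose]
  simp [transpose_add, transpose_mul, this]

lemma isUnit_det_lap (hh : h ≠ 0) : IsUnit (lap nx ny h).det := by
  rw [isUnit_iff_ne_zero]
  intro h0
  obtain ⟨w, hw, hz⟩ := exists_mulVec_eq_zero_iff.mpr h0
  have := energy_pos hh hw
  simp [hz] at this

lemma schur_transpose : (schur nx ny h)ᵀ = schur nx ny h := by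
  have e : (grad nx ny h)ᵀ = -div nx ny h := by
    rw [grad_eq, transpose_neg, transpose_transpose]
  have e' : (div nx ny h)ᵀ = -grad nx ny h := by rw [grad_eq, neg_neg]
  rw [schur, transpose_mul, transpose_mul, transpose_nonsing_inv, lap_transpose, e, e']
  simp [Matrix.mul_assoc]

lemma schur_isHermitian : (schur nx ny h).IsHermitian := by
  rw [IsHermitian, conjTranspose_eq_transpose_of_trivial, schur_transpose]

/-- The velocity `z` solving `L z = G q`. -/
lemma exists_velocity (hh : h ≠ 0) (q : Cell nx ny → ℝ) : ∃ z : Face nx ny → ℝ,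
    lap nx ny h *ᵥ z = grad nx ny h *ᵥ q ∧ div nx ny h *ᵥ z = schur nx ny h *ᵥ q := by
  refine ⟨(lap nx ny h)⁻¹ *ᵥ (grad nx ny h *ᵥ q), ?_, ?_⟩
  · rw [mulVec_mulVec, mul_nonsing_inv _ (isUnit_det_lap hh), one_mulVec]
  · rw [schur, mulVec_mulVec, mulVec_mulVec, Matrix.mul_assoc]

lemma dotProduct_grad (w : Face nx ny → ℝ) (q : Cell nx ny → ℝ) :
    w ⬝ᵥ grad nx ny h *ᵥ q = -(q ⬝ᵥ div nx ny h *ᵥ w) := by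
  rw [grad_eq, neg_mulVec, dotProduct_neg, mulVec_transpose, dotProduct_comm, dotProduct_mulVec]

lemma dotProduct_lap_comm (w z : Face nx ny → ℝ) :
    w ⬝ᵥ lap nx ny h *ᵥ z = z ⬝ᵥ lap nx ny h *ᵥ w := by
  rw [dotProduct_mulVec, ← mulVec_transpose, lap_transpose, dotProduct_comm]

/-- Cauchy–Schwarz for the semidefinite form `-L`, from the discriminant of `t ↦ E(w + t z) ≥ 0`. -/
lemma dotProduct_lap_sq_le (w z : Face nx ny → ℝ) : (w ⬝ᵥ lap nx ny h *ᵥ z) ^ 2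
    ≤ (w ⬝ᵥ lap nx ny h *ᵥ w) * (z ⬝ᵥ lap nx ny h *ᵥ z) := by
  have key : ∀ t : ℝ, 0 ≤ -(z ⬝ᵥ lap nx ny h *ᵥ z) * (t * t)
      + (-2 * (w ⬝ᵥ lap nx ny h *ᵥ z)) * t + -(w ⬝ᵥ lap nx ny h *ᵥ w) := by
    intro t
    have := energy_nonneg (h := h) (w + t • z)
    rw [mulVec_add, mulVec_smul, dotProduct_add, add_dotProduct, add_dotProduct, dotProduct_smul,
      dotProduct_smul, smul_dotProduct, smul_dotProduct, dotProduct_lap_comm z w] at this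
    simp only [smul_eq_mul] at this
    linarith
  have := discrim_le_zero key
  rw [discrim] at this
  linarith

lemma dotProduct_schur (hh : h ≠ 0) (q : Cell nx ny → ℝ) : ∃ z : Face nx ny → ℝ,
    lap nx ny h *ᵥ z = grad nx ny h *ᵥ q ∧ div nx ny h *ᵥ z = schur nx ny h *ᵥ q ∧
    q ⬝ᵥ schur nx ny h *ᵥ q = -(z ⬝ᵥ lap nx ny h *ᵥ z) := by
  obtain ⟨z, h1, h2⟩ := exists_velocity hh q
  exact ⟨z, h1, h2, by rw [h1, dotProduct_grad, h2, neg_neg]⟩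

/-! ### Eigenvalues, kernel and rank of the Schur complement -/

lemma dotProduct_self_pos {ι : Type*} [Fintype ι] {q : ι → ℝ} (hq : q ≠ 0) : 0 < q ⬝ᵥ q := by
  refine lt_of_le_of_ne (Finset.sum_nonneg fun i _ => mul_self_nonneg _) fun h0 => hq ?_
  exact dotProduct_self_eq_zero.mp h0.symm

/-- With `Lz = Gq`, the inequality `|Dz|² ≤ E(z)` reads `μ²|q|² ≤ μ|q|²`. -/
lemma eigenvalue_mem (hh : h ≠ 0) {q : Cell nx ny → ℝ} (hq : q ≠ 0) {μ : ℝ}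
    (hS : schur nx ny h *ᵥ q = μ • q) : 0 ≤ μ ∧ μ ≤ 1 := by
  obtain ⟨z, h1, h2, h3⟩ := dotProduct_schur hh q
  have hpos := dotProduct_self_pos hq
  rw [hS, dotProduct_smul, smul_eq_mul] at h3
  have e0 := energy_nonneg (h := h) z
  have e1 := div_sq_le_energy nx ny h z
  rw [h2, hS, dotProduct_smul, smul_dotProduct, smul_eq_mul, smul_eq_mul, ← h3] at e1
  rw [← h3] at e0
  have hμ : 0 ≤ μ := nonneg_of_mul_nonneg_left e0 hpos
  refine ⟨hμ, ?_⟩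
  rcases hμ.eq_or_lt with h0 | h0
  · rw [← h0]; exact zero_le_one
  · have : μ * (μ * (q ⬝ᵥ q)) ≤ 1 * (μ * (q ⬝ᵥ q)) := by linarith
    exact le_of_mul_le_mul_right this (mul_pos h0 hpos)

/-- With `Lz = Gq` one has `w·Lz = -q·Dw` and `E(z) = μ|q|²`, so this is Cauchy–Schwarz in the
energy. It is the link between eigenvalues and the inf-sup quotient. -/
lemma eigenvalue_bound (hh : h ≠ 0) {q : Cell nx ny → ℝ} {μ : ℝ}
    (hS : schur nx ny h *ᵥ q = μ • q) (w : Face nx ny → ℝ) :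
    (q ⬝ᵥ div nx ny h *ᵥ w) ^ 2 ≤ μ * (q ⬝ᵥ q) * -(w ⬝ᵥ lap nx ny h *ᵥ w) := by
  obtain ⟨z, h1, h2, h3⟩ := dotProduct_schur hh q
  rw [hS, dotProduct_smul, smul_eq_mul] at h3
  have := dotProduct_lap_sq_le (h := h) w z
  rw [h1, dotProduct_grad] at this
  rw [h3, ← h1] at *
  linarith

lemma grad_one : grad nx ny h *ᵥ (fun _ => 1) = 0 := by
  ext i
  rw [grad, fromRows_mulVec]
  rcases i with ⟨k, j⟩ | ⟨i, k⟩
  · rw [Sum.elim_inl, kronecker_one_mulVec, sum_cellToFace]; simp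
  · rw [Sum.elim_inr, one_kronecker_mulVec, sum_cellToFace]; simp

lemma grad_inl (q : Cell nx ny → ℝ) (k : Fin (nx - 1)) (j : Fin ny) :
    (grad nx ny h *ᵥ q) (Sum.inl (k, j))
      = h⁻¹ * (q (⟨k + 1, by omega⟩, j) - q (⟨k, by omega⟩, j)) := by
  rw [grad, fromRows_mulVec, Sum.elim_inl, kronecker_one_mulVec, sum_cellToFace]

lemma grad_inr (q : Cell nx ny → ℝ) (i : Fin nx) (k : Fin (ny - 1)) :
    (grad nx ny h *ᵥ q) (Sum.inr (i, k))
      = h⁻¹ * (q (i, ⟨k + 1, by omega⟩) - q (i, ⟨k, by omega⟩)) := by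
  rw [grad, fromRows_mulVec, Sum.elim_inr, one_kronecker_mulVec, sum_cellToFace]

lemma eq_of_succ_eq {n : ℕ} (g : Fin n → ℝ)
    (hg : ∀ k (hk : k + 1 < n), g ⟨k + 1, hk⟩ = g ⟨k, by omega⟩) (i j : Fin n) : g i = g j := by
  have key : ∀ k (hk : k < n), g ⟨k, hk⟩ = g ⟨0, by omega⟩ := by
    intro k
    induction k with
    | zero => intro _; rfl
    | succ k ih => intro hk; rw [hg k hk, ih]
  rw [← Fin.eta i i.2, ← Fin.eta j j.2, key, key j.1 j.2]

lemma eq_of_grad_eq_zero (hh : h ≠ 0) {q : Cell nx ny → ℝ} (hq : grad nx ny h *ᵥ q = 0)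
    (c d : Cell nx ny) : q c = q d := by
  have hx : ∀ (i i' : Fin nx) (j : Fin ny), q (i, j) = q (i', j) := fun i i' j =>
    eq_of_succ_eq (fun i => q (i, j)) (fun k hk => by
      have := congrFun hq (Sum.inl (⟨k, by omega⟩, j))
      rw [grad_inl] at this
      simpa [hh, sub_eq_zero] using this) i i'
  have hy : ∀ (i : Fin nx) (j j' : Fin ny), q (i, j) = q (i, j') := fun i j j' =>
    eq_of_succ_eq (fun j => q (i, j)) (fun k hk => by
      have := congrFun hq (Sum.inr (i, ⟨k, by omega⟩))
      rw [grad_inr] at this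
      simpa [hh, sub_eq_zero] using this) j j'
  rw [← Prod.mk.eta (p := c), ← Prod.mk.eta (p := d), hx c.1 d.1, hy d.1 c.2 d.2]

lemma schur_one : schur nx ny h *ᵥ (fun _ => 1) = 0 := by
  rw [schur, ← mulVec_mulVec, grad_one, mulVec_zero]

/-- The symmetric matrix `S` annihilates constants, so its other eigenspaces are orthogonal to them.
-/
lemma sum_eq_zero_of_eigenvector {q : Cell nx ny → ℝ} {μ : ℝ}
    (hS : schur nx ny h *ᵥ q = μ • q) (hμ : μ ≠ 0) : ∑ c, q c = 0 := by
  have h1 : (fun _ => 1) ⬝ᵥ schur nx ny h *ᵥ q = 0 := by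
    rw [dotProduct_mulVec, ← mulVec_transpose, schur_transpose, schur_one, zero_dotProduct]
  rw [hS, dotProduct_smul, smul_eq_mul, mul_eq_zero] at h1
  simpa [dotProduct] using h1.resolve_left hμ

lemma grad_eq_zero_of_schur_eq_zero (hh : h ≠ 0) {q : Cell nx ny → ℝ}
    (hS : schur nx ny h *ᵥ q = 0) : grad nx ny h *ᵥ q = 0 := by
  obtain ⟨z, h1, h2, h3⟩ := dotProduct_schur hh q
  rw [hS, dotProduct_zero] at h3
  have : z = 0 := by
    by_contra hz
    linarith [energy_pos hh hz]
  rw [← h1, this, mulVec_zero]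

/-- A constant kernel has dimension one. -/
lemma finrank_ker_of_const {ι : Type*} [Fintype ι] [Nonempty ι] [DecidableEq ι]
    (A : Matrix ι ι ℝ) (h1 : A *ᵥ (fun _ => 1) = 0)
    (h2 : ∀ q, A *ᵥ q = 0 → ∀ c d, q c = q d) :
    Module.finrank ℝ (LinearMap.ker A.mulVecLin) = 1 := by
  have : LinearMap.ker A.mulVecLin = ℝ ∙ (fun _ : ι => (1 : ℝ)) := by
    ext q
    rw [LinearMap.mem_ker, mulVecLin_apply, Submodule.mem_span_singleton]
    constructor
    · intro hq
      exact ⟨q (Classical.arbitrary ι), by ext c; simpa using h2 q hq _ _⟩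
    · rintro ⟨t, rfl⟩
      rw [mulVec_smul, h1, smul_zero]
  rw [this, finrank_span_singleton]
  intro h0
  simpa using congrFun h0 (Classical.arbitrary ι)

lemma rank_add_finrank_ker {ι : Type*} [Fintype ι] [DecidableEq ι] (A : Matrix ι ι ℝ) :
    A.rank + Module.finrank ℝ (LinearMap.ker A.mulVecLin) = Fintype.card ι := by
  rw [Matrix.rank, LinearMap.finrank_range_add_finrank_ker, Module.finrank_pi]

lemma rank_schur (hx : 0 < nx) (hy : 0 < ny) (hh : h ≠ 0) : (schur nx ny h).rank + 1 = nx * ny := by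
  have : Nonempty (Cell nx ny) := ⟨(⟨0, hx⟩, ⟨0, hy⟩)⟩
  have := rank_add_finrank_ker (schur nx ny h)
  rw [finrank_ker_of_const _ schur_one fun q hq =>
    eq_of_grad_eq_zero hh (grad_eq_zero_of_schur_eq_zero hh hq)] at this
  simpa using this

/-- The Neumann Laplacian attains every mean-zero right-hand side. -/
lemma exists_potential (hx : 0 < nx) (hy : 0 < ny) (hh : h ≠ 0) (q : Cell nx ny → ℝ)
    (hq : ∑ c, q c = 0) : ∃ φ, div nx ny h *ᵥ (grad nx ny h *ᵥ φ) = q := by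
  have : Nonempty (Cell nx ny) := ⟨(⟨0, hx⟩, ⟨0, hy⟩)⟩
  set A := div nx ny h * grad nx ny h with hA
  have hker : ∀ q, A *ᵥ q = 0 → grad nx ny h *ᵥ q = 0 := by
    intro q hq
    have : (grad nx ny h *ᵥ q) ⬝ᵥ (grad nx ny h *ᵥ q) = 0 := by
      rw [dotProduct_grad, mulVec_mulVec, hq, dotProduct_zero, neg_zero]
    exact dotProduct_self_eq_zero.mp this
  have hr := rank_add_finrank_ker A
  rw [finrank_ker_of_const A (by rw [hA, ← mulVec_mulVec, grad_one, mulVec_zero])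
    fun q hq => eq_of_grad_eq_zero hh (hker q hq)] at hr
  let s : (Cell nx ny → ℝ) →ₗ[ℝ] ℝ := ∑ c, LinearMap.proj c
  have hs : ∀ q, s q = ∑ c, q c := fun q => by simp [s]
  have hle : LinearMap.range A.mulVecLin ≤ LinearMap.ker s := by
    rintro _ ⟨p, rfl⟩
    rw [LinearMap.mem_ker, hs, mulVecLin_apply, hA, ← mulVec_mulVec]
    have := dotProduct_grad (h := h) (grad nx ny h *ᵥ p) (fun _ => 1)
    rw [grad_one, dotProduct_zero] at this
    simpa [dotProduct] using this
  have hsurj : Module.finrank ℝ (LinearMap.range s) = 1 := by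
    rw [LinearMap.range_eq_top.mpr, finrank_top, Module.finrank_self]
    intro t
    refine ⟨Pi.single (Classical.arbitrary _) t, ?_⟩
    rw [hs, Finset.sum_pi_single']
    simp
  have hd := LinearMap.finrank_range_add_finrank_ker s
  rw [hsurj, Module.finrank_pi] at hd
  -- The range of `DG` lies in the mean-zero space, and both have codimension one.
  have heq := Submodule.eq_of_le_of_finrank_eq hle (by rw [Matrix.rank] at hr; omega)
  have : q ∈ LinearMap.range A.mulVecLin := by rw [heq, LinearMap.mem_ker, hs, hq]
  obtain ⟨φ, hφ⟩ := this
  exact ⟨φ, by rw [mulVec_mulVec, ← hA, ← hφ, mulVecLin_apply]⟩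

end


section

/-! ### Multiplicities -/

/-- Diagonalization turns the rank into a count of eigenvalues, so that multiplicities follow from
kernels of `S - μ`. -/
lemma rank_sub_smul_one {ι : Type*} [Fintype ι] [DecidableEq ι] {A : Matrix ι ι ℝ}
    (hA : A.IsHermitian) (μ : ℝ) :
    (A - μ • (1 : Matrix ι ι ℝ)).rank = Fintype.card {i // hA.eigenvalues i ≠ μ} := by
  have e : A - μ • (1 : Matrix ι ι ℝ) = Unitary.conjStarAlgAut ℝ _ hA.eigenvectorUnitary
      (diagonal fun i => hA.eigenvalues i - μ) := by
    conv_lhs => rw [hA.spectral_theorem]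
    rw [← diagonal_sub, map_sub]
    congr 1
    rw [show (diagonal fun _ : ι => μ) = μ • (1 : Matrix ι ι ℝ) by
      rw [← diagonal_one, ← diagonal_smul]; congr 1; ext; simp, map_smul, map_one]
  rw [e, Unitary.conjStarAlgAut_apply, ← Unitary.coe_star]
  simp [-isUnit_iff_ne_zero, -Unitary.coe_star, Matrix.rank_diagonal, sub_ne_zero]

variable {nx ny : ℕ} {h : ℝ}

/-- A face running along a wall lies between two cells that touch this wall, so `W` annihilates
`Gp`; so does the curl. What remains of `-L` on `Gp` is `DᵀD`, that is, `LGp = GDGp`, and applying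
`DL⁻¹` gives the claim. -/
lemma schur_mulVec_of_boundary_eq_zero (hh : h ≠ 0) (p : Cell nx ny → ℝ)
    (hp : ∀ c : Cell nx ny, c.1.val = 0 ∨ c.1.val + 1 = nx ∨ c.2.val = 0 ∨ c.2.val + 1 = ny →
      p c = 0) :
    schur nx ny h *ᵥ (div nx ny h *ᵥ (grad nx ny h *ᵥ p))
      = div nx ny h *ᵥ (grad nx ny h *ᵥ p) := by
  have hw : wall nx ny *ᵥ (grad nx ny h *ᵥ p) = 0 := by
    ext i
    rw [wall_eq, mulVec_diagonal]
    rcases i with ⟨k, j⟩ | ⟨i, k⟩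
    · rw [grad_inl]
      by_cases hj : j.val = 0 ∨ j.val + 1 = ny
      · rw [hp _ (by simp only; tauto), hp (_, _) (by simp only; tauto)]; simp
      · push Not at hj
        simp [hj]
    · rw [grad_inr]
      by_cases hi : i.val = 0 ∨ i.val + 1 = nx
      · rw [hp _ (by simp only; tauto), hp (_, _) (by simp only; tauto)]; simp
      · push Not at hi
        simp [hi]
  have hL : lap nx ny h *ᵥ (grad nx ny h *ᵥ p)
      = grad nx ny h *ᵥ (div nx ny h *ᵥ (grad nx ny h *ᵥ p)) := by
    have hC : curl nx ny h *ᵥ (grad nx ny h *ᵥ p) = 0 := by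
      rw [mulVec_mulVec, curl_mul_grad, zero_mulVec]
    rw [← neg_inj, ← neg_mulVec, neg_lap_eq, add_mulVec, add_mulVec, smul_mulVec, hw,
      ← mulVec_mulVec, ← mulVec_mulVec _ (curl nx ny h)ᵀ, hC, grad_eq]
    simp [neg_mulVec]
  rw [schur, ← mulVec_mulVec, ← mulVec_mulVec, ← hL, mulVec_mulVec _ _ (lap nx ny h),
    nonsing_inv_mul _ (isUnit_det_lap hh), one_mulVec]

lemma rank_schur_sub_one (hx : 0 < nx) (hy : 0 < ny) (hh : h ≠ 0) :
    (schur nx ny h - (1 : ℝ) • 1).rank + (nx - 2) * (ny - 2) ≤ nx * ny := by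
  -- These are the cells touching no wall. Pressures supported on them are mapped injectively by
  -- `DG`, since a constant vanishing at a corner is zero.
  let e : Fin (nx - 2) × Fin (ny - 2) → Cell nx ny :=
    fun c => (⟨c.1 + 1, by omega⟩, ⟨c.2 + 1, by omega⟩)
  have he : Function.Injective e := by
    rintro ⟨a, b⟩ ⟨c, d⟩ hcd
    simpa [e, Fin.ext_iff] using hcd
  let E := Function.ExtendByZero.linearMap ℝ e
  have hE : ∀ r c, c.1.val = 0 ∨ c.1.val + 1 = nx ∨ c.2.val = 0 ∨ c.2.val + 1 = ny →
      E r c = 0 := by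
    intro r c hc
    refine Function.extend_apply' _ _ _ ?_
    rintro ⟨d, rfl⟩
    simp only [e] at hc
    omega
  let T : (Fin (nx - 2) × Fin (ny - 2) → ℝ) →ₗ[ℝ] (Cell nx ny → ℝ) :=
    (div nx ny h).mulVecLin ∘ₗ (grad nx ny h).mulVecLin ∘ₗ E
  have hT : Function.Injective T := by
    rw [← LinearMap.ker_eq_bot, LinearMap.ker_eq_bot']
    intro r hr
    have h0 : div nx ny h *ᵥ (grad nx ny h *ᵥ E r) = 0 := hr
    have h1 : grad nx ny h *ᵥ E r = 0 := by
      have : (grad nx ny h *ᵥ E r) ⬝ᵥ (grad nx ny h *ᵥ E r) = 0 := by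
        rw [dotProduct_grad, h0, dotProduct_zero, neg_zero]
      exact dotProduct_self_eq_zero.mp this
    ext c
    have h2 : E r (e c) = r c := he.extend_apply _ _ _
    rw [← h2, eq_of_grad_eq_zero hh h1 (e c) (⟨0, hx⟩, ⟨0, hy⟩), hE r _ (Or.inl rfl)]
    rfl
  have hle : LinearMap.range T ≤ LinearMap.ker (schur nx ny h - (1 : ℝ) • 1).mulVecLin := by
    rintro _ ⟨r, rfl⟩
    rw [LinearMap.mem_ker, mulVecLin_apply, sub_mulVec, one_smul, one_mulVec, sub_eq_zero]
    exact schur_mulVec_of_boundary_eq_zero hh (E r) (hE r)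
  have h1 := Submodule.finrank_mono hle
  rw [LinearMap.finrank_range_of_inj hT, Module.finrank_pi] at h1
  have h2 := rank_add_finrank_ker (schur nx ny h - (1 : ℝ) • 1)
  simp only [Fintype.card_prod, Fintype.card_fin] at h1 h2
  omega

/-! ### Passage to the complex characteristic polynomial -/

lemma roots_charpoly_schurC : (schurC nx ny h).charpoly.roots
    = Multiset.map (fun c => ((schur_isHermitian (nx := nx) (ny := ny) (h := h)).eigenvalues c : ℂ))
        Finset.univ.val := by
  have e : (schurC nx ny h).charpoly = (schur nx ny h).charpoly.map Complex.ofRealHom := by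
    rw [← charpoly_map]; rfl
  rw [e, (schur_isHermitian (nx := nx) (ny := ny) (h := h)).splits_charpoly.roots_map,
    schur_isHermitian.roots_charpoly_eq_eigenvalues, Multiset.map_map]
  rfl

lemma count_zero_roots_schurC (hx : 0 < nx) (hy : 0 < ny) (hh : h ≠ 0) :
    (schurC nx ny h).charpoly.roots.count 0 = 1 := by
  classical
  have h1 := rank_schur hx hy hh
  rw [schur_isHermitian.rank_eq_card_non_zero_eigs, Fintype.card_subtype_compl,
    Fintype.card_prod, Fintype.card_fin, Fintype.card_fin] at h1
  have h2 := Fintype.card_subtype_le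
    fun c => (schur_isHermitian (nx := nx) (ny := ny) (h := h)).eigenvalues c = 0
  rw [Fintype.card_prod, Fintype.card_fin, Fintype.card_fin] at h2
  have h3 : Fintype.card {c // (schur_isHermitian (nx := nx) (ny := ny) (h := h)).eigenvalues c = 0}
      = 1 := by omega
  rw [roots_charpoly_schurC, Multiset.count_map, ← h3, Fintype.card_subtype]
  simp only [Finset.card_def, Finset.filter_val]
  congr 2
  ext c
  rw [eq_comm]
  exact Complex.ofReal_eq_zero

lemma card_roots_schurC_ne_one (hx : 0 < nx) (hy : 0 < ny) (hh : h ≠ 0) (hxy : 2 ≤ nx * ny) :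
    ((schurC nx ny h).charpoly.roots.filter (fun z => z ≠ 1)).card
      ≤ 2 * (nx - 1) + 2 * (ny - 1) := by
  classical
  have h1 := rank_schur_sub_one hx hy hh
  rw [rank_sub_smul_one schur_isHermitian] at h1
  have h3 : ((schurC nx ny h).charpoly.roots.filter (fun z => z ≠ 1)).card = Fintype.card
      {c // (schur_isHermitian (nx := nx) (ny := ny) (h := h)).eigenvalues c ≠ 1} := by
    rw [roots_charpoly_schurC, Multiset.filter_map, Multiset.card_map, Fintype.card_subtype,
      Finset.card_def, Finset.filter_val]
    congr 2
    ext c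
    simp
  rw [h3]
  obtain ⟨a, rfl⟩ : ∃ a, nx = a + 1 := ⟨nx - 1, by omega⟩
  obtain ⟨b, rfl⟩ : ∃ b, ny = b + 1 := ⟨ny - 1, by omega⟩
  -- On a grid one cell wide `nx - 2` truncates to zero and the rank bound is only `nx * ny`; this
  -- still suffices once there are two cells.
  rcases a with _ | a
  · simp at h1 hxy ⊢; omega
  rcases b with _ | b
  · simp at h1 hxy ⊢; omega
  have : (a + 1 + 1) * (b + 1 + 1) = a * b + 2 * a + 2 * b + 4 := by ring
  simp only [Nat.add_sub_cancel, show a + 1 + 1 - 2 = a by omega, show b + 1 + 1 - 2 = b by omega]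
    at h1 ⊢
  omega

lemma spectrum_schurC_subset (hh : h ≠ 0) {β : ℝ}
    (hβ : ∀ (q : Cell nx ny → ℝ) (μ : ℝ), q ≠ 0 → ∑ c, q c = 0 → schur nx ny h *ᵥ q = μ • q →
      β ≤ μ) :
    spectrum ℂ (schurC nx ny h) ⊆ (fun x : ℝ => (x : ℂ)) '' ({0} ∪ Set.Icc β 1) := by
  intro z hz
  rw [mem_spectrum_iff_isRoot_charpoly, ← Polynomial.mem_roots (charpoly_monic _).ne_zero,
    roots_charpoly_schurC, Multiset.mem_map] at hz
  obtain ⟨c, -, rfl⟩ := hz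
  refine ⟨_, ?_, rfl⟩
  set μ := (schur_isHermitian (nx := nx) (ny := ny) (h := h)).eigenvalues c with hμ
  set q : Cell nx ny → ℝ :=
    ⇑((schur_isHermitian (nx := nx) (ny := ny) (h := h)).eigenvectorBasis c) with hq
  have hS : schur nx ny h *ᵥ q = μ • q := schur_isHermitian.mulVec_eigenvectorBasis c
  have hq0 : q ≠ 0 := by
    intro h0
    refine (schur_isHermitian (nx := nx) (ny := ny) (h := h)).eigenvectorBasis.orthonormal.ne_zero c
      ?_
    ext d
    exact congrFun h0 d
  by_cases h0 : μ = 0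
  · exact Or.inl h0
  · exact Or.inr ⟨hβ q μ hq0 (sum_eq_zero_of_eigenvector hS h0) hS,
      (eigenvalue_mem hh hq0 hS).2⟩

end


/-! ### Extension from outside an interval in one dimension -/

/-- A cubic cutoff, equal to `1` up to `0` and to `0` from `n` on. -/
noncomputable def cutoff (n i : ℤ) : ℝ :=
  if i ≤ 0 then 1 else if n ≤ i then 0 else (1 - i / n) ^ 2 * (1 + 2 * (i / n))

lemma cutoff_of_nonpos {n i : ℤ} (hi : i ≤ 0) : cutoff n i = 1 := if_pos hi

lemma cutoff_of_ge {n i : ℤ} (hn : 0 < n) (hi : n ≤ i) : cutoff n i = 0 := by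
  rw [cutoff, if_neg (by omega), if_pos hi]

lemma cutoff_of_mem {n i : ℤ} (hn : 0 < n) (h0 : 0 ≤ i) (h1 : i ≤ n) :
    cutoff n i = (1 - i / n) ^ 2 * (1 + 2 * (i / n)) := by
  have hn' : (n : ℝ) ≠ 0 := by exact_mod_cast hn.ne'
  rcases h0.eq_or_lt with rfl | h0
  · simp [cutoff]
  rcases h1.eq_or_lt with rfl | h1
  · rw [cutoff_of_ge hn le_rfl, div_self hn']; ring
  · rw [cutoff, if_neg (by omega), if_neg (by omega)]

lemma abs_cutoff_le {n i : ℤ} (hn : 0 < n) : |cutoff n i| ≤ 1 := by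
  have hn' : (0 : ℝ) < n := by exact_mod_cast hn
  rcases le_or_gt i 0 with h0 | h0
  · simp [cutoff_of_nonpos h0]
  rcases le_or_gt n i with h1 | h1
  · simp [cutoff_of_ge hn h1]
  rw [cutoff_of_mem hn h0.le h1.le]
  have t0 : (0 : ℝ) ≤ i / n := div_nonneg (by exact_mod_cast h0.le) hn'.le
  have t1 : (i : ℝ) / n ≤ 1 := (div_le_one hn').mpr (by exact_mod_cast h1.le)
  set t : ℝ := i / n
  rw [abs_of_nonneg (by positivity)]
  nlinarith [mul_nonneg t0 t0, mul_nonneg (mul_nonneg t0 t0) (sub_nonneg.mpr t1)]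

lemma abs_cutoff_diff_le {n i : ℤ} (hn : 0 < n) : |cutoff n (i + 1) - cutoff n i| ≤ 6 / n := by
  have hn' : (0 : ℝ) < n := by exact_mod_cast hn
  have hnn : 0 ≤ (6 : ℝ) / n := by positivity
  rcases lt_or_ge i 0 with h0 | h0
  · rw [cutoff_of_nonpos (by omega), cutoff_of_nonpos (by omega)]; simpa using hnn
  rcases le_or_gt n i with h1 | h1
  · rw [cutoff_of_ge hn (by omega), cutoff_of_ge hn (by omega)]; simpa using hnn
  rw [cutoff_of_mem hn h0 h1.le, cutoff_of_mem hn (by omega) (by omega)]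
  have t0 : (0 : ℝ) ≤ i / n := div_nonneg (by exact_mod_cast h0) hn'.le
  have e0 : (0 : ℝ) < 1 / n := by positivity
  have t1 : (i : ℝ) / n + 1 / n ≤ 1 := by
    rw [← add_div, div_le_one hn']; exact_mod_cast h1
  rw [show ((i + 1 : ℤ) : ℝ) / n = i / n + 1 / n by push_cast; ring,
    show (6 : ℝ) / n = 6 * (1 / n) by ring]
  set t : ℝ := i / n
  set e : ℝ := 1 / (n : ℝ)
  rw [show (1 - (t + e)) ^ 2 * (1 + 2 * (t + e)) - (1 - t) ^ 2 * (1 + 2 * t)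
    = e * (6 * t ^ 2 - 6 * t + 6 * t * e - 3 * e + 2 * e ^ 2) by ring, abs_mul, abs_of_pos e0,
    mul_comm]
  refine mul_le_mul_of_nonneg_right ?_ e0.le
  rw [abs_le]
  constructor <;> nlinarith [mul_nonneg t0 e0.le, mul_nonneg t0 (sub_nonneg.mpr t1),
    mul_nonneg e0.le (sub_nonneg.mpr t1)]

/-- The cubic `(1 - t)²(1 + 2t)` has zero slope at both ends, so its junctions with the constants 1
and 0 also contribute only `O(n⁻²)`. -/
lemma abs_cutoff_diff2_le {n i : ℤ} (hn : 0 < n) :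
    |cutoff n (i + 1) - 2 * cutoff n i + cutoff n (i - 1)| ≤ 6 / n ^ 2 := by
  have hn' : (0 : ℝ) < n := by exact_mod_cast hn
  have hnn : 0 ≤ (6 : ℝ) / n ^ 2 := by positivity
  have e0 : (0 : ℝ) < 1 / n := by positivity
  have e1 : 1 / (n : ℝ) ≤ 1 := by
    rw [div_le_one hn']; exact_mod_cast hn
  have h6 : (6 : ℝ) / n ^ 2 = 6 * (1 / n) ^ 2 := by ring
  rcases lt_or_ge i 0 with h0 | h0
  · rw [cutoff_of_nonpos (by omega), cutoff_of_nonpos (by omega), cutoff_of_nonpos (by omega)]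
    norm_num; positivity
  rcases lt_or_ge n i with h1 | h1
  · rw [cutoff_of_ge hn (by omega), cutoff_of_ge hn (by omega), cutoff_of_ge hn (by omega)]
    norm_num; positivity
  rw [h6]
  rcases h0.eq_or_lt with rfl | h0
  · rw [cutoff_of_nonpos le_rfl, cutoff_of_nonpos (i := 0 - 1) (by omega), zero_add,
      cutoff_of_mem hn (by omega) (by omega)]
    push_cast
    set e : ℝ := 1 / (n : ℝ)
    rw [show (1 - e) ^ 2 * (1 + 2 * e) - 2 * 1 + 1 = -((3 - 2 * e) * e ^ 2) by ring, abs_neg,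
      abs_of_nonneg (mul_nonneg (by linarith) (sq_nonneg _))]
    exact mul_le_mul_of_nonneg_right (by linarith) (sq_nonneg _)
  rcases h1.eq_or_lt with rfl | h1
  · rw [cutoff_of_ge hn le_rfl, cutoff_of_ge hn (by omega), cutoff_of_mem hn (by omega) (by omega)]
    rw [show ((i - 1 : ℤ) : ℝ) / i = 1 - 1 / i by push_cast; field_simp]
    set e : ℝ := 1 / (i : ℝ)
    rw [show 0 - 2 * 0 + (1 - (1 - e)) ^ 2 * (1 + 2 * (1 - e)) = (3 - 2 * e) * e ^ 2 by ring,
      abs_of_nonneg (mul_nonneg (by linarith) (sq_nonneg _))]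
    exact mul_le_mul_of_nonneg_right (by linarith) (sq_nonneg _)
  rw [cutoff_of_mem hn (by omega) (by omega), cutoff_of_mem hn (by omega) (by omega),
    cutoff_of_mem hn (by omega) (by omega)]
  have t0 : (0 : ℝ) ≤ i / n := div_nonneg (by exact_mod_cast h0.le) hn'.le
  have t1 : (i : ℝ) / n ≤ 1 := (div_le_one hn').mpr (by exact_mod_cast h1.le)
  rw [show ((i + 1 : ℤ) : ℝ) / n = i / n + 1 / n by push_cast; ring,
    show ((i - 1 : ℤ) : ℝ) / n = i / n - 1 / n by push_cast; ring]
  set t : ℝ := i / n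
  set e : ℝ := 1 / (n : ℝ)
  rw [show (1 - (t + e)) ^ 2 * (1 + 2 * (t + e)) - 2 * ((1 - t) ^ 2 * (1 + 2 * t))
    + (1 - (t - e)) ^ 2 * (1 + 2 * (t - e)) = (12 * t - 6) * e ^ 2 by ring, abs_mul,
    abs_of_nonneg (sq_nonneg e)]
  refine mul_le_mul_of_nonneg_right ?_ (sq_nonneg _)
  rw [abs_le]
  constructor <;> linarith

/-- Reflection of the values at `i ≤ 0` that keeps values and first differences. -/
def reflect (f : ℤ → ℝ) (i : ℤ) : ℝ := if i ≤ 0 then f i else 3 * f (-i) - 2 * f (-(2 * i))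

/-- Reflection with cutoff. -/
noncomputable def halfExt (n : ℤ) (f : ℤ → ℝ) (i : ℤ) : ℝ := cutoff n i * reflect f i

/-- Extension of the values of `f` outside `(0, n)` to the whole line. -/
noncomputable def ext (n : ℤ) (f : ℤ → ℝ) (i : ℤ) : ℝ :=
  halfExt n f i + halfExt n (fun k => f (n - k)) (n - i)

/-- Each of the two cutoffs is 1 on its own side of the interval and 0 on the other. -/
lemma ext_of_outer {n i : ℤ} (hn : 0 < n) (f : ℤ → ℝ) (hi : i ≤ 0 ∨ n ≤ i) : ext n f i = f i := by
  rcases hi with hi | hi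
  · rw [ext, halfExt, halfExt, cutoff_of_nonpos hi, cutoff_of_ge hn (by omega), reflect, if_pos hi]
    ring
  · rw [ext, halfExt, halfExt, cutoff_of_ge hn hi, cutoff_of_nonpos (by omega), reflect, reflect,
      if_pos (by omega : n - i ≤ 0), sub_sub_cancel]
    ring

lemma reflect_sub (f g : ℤ → ℝ) (i : ℤ) :
    reflect (fun k => f k - g k) i = reflect f i - reflect g i := by
  simp only [reflect]
  split_ifs <;> ring

/-- Linearity lets the extension in one variable commute with differences in the other: the
transverse difference of an extended stream function is the extension of a velocity component. -/
lemma ext_sub (n : ℤ) (f g : ℤ → ℝ) (i : ℤ) :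
    ext n (fun k => f k - g k) i = ext n f i - ext n g i := by
  simp only [ext, halfExt]
  rw [reflect_sub, reflect_sub (fun k => f (n - k)) fun k => g (n - k)]
  ring

/-- `ext` uses the values outside the interval only. -/
lemma ext_congr {n i : ℤ} (h0 : 0 ≤ i) (h1 : i ≤ n) {f g : ℤ → ℝ}
    (hfg : ∀ k, -(2 * n) ≤ k → k ≤ 3 * n → (k ≤ 0 ∨ n ≤ k) → f k = g k) :
    ext n f i = ext n g i := by
  have key : ∀ (f g : ℤ → ℝ), (∀ k, -(2 * n) ≤ k → k ≤ 0 → f k = g k) →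
      ∀ i, 0 ≤ i → i ≤ n → reflect f i = reflect g i := by
    intro f g hfg i h0 h1
    rw [reflect, reflect]
    split_ifs with hi
    · exact hfg _ (by omega) hi
    · rw [hfg _ (by omega) (by omega), hfg _ (by omega) (by omega)]
  rw [ext, ext, halfExt, halfExt, halfExt, halfExt,
    key f g (fun k hk hk' => hfg k hk (by omega) (Or.inl hk')) i h0 h1,
    key (fun k => f (n - k)) (fun k => g (n - k))
      (fun k hk hk' => hfg _ (by omega) (by omega) (Or.inr (by omega))) (n - i) (by omega)
      (by omega)]

lemma ext_zero {n i : ℤ} : ext n (fun _ => 0) i = 0 := by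
  simp [ext, halfExt, reflect]

/-- Reindexing a sum of nonnegative terms injectively, discarding terms that vanish. -/
lemma sum_comp_le {s t : Finset ℤ} {g : ℤ → ℝ} (hg : ∀ k ∈ t, 0 ≤ g k) (σ : ℤ → ℤ)
    (hσ : Function.Injective σ) (hst : ∀ i ∈ s, σ i ∉ t → g (σ i) = 0) :
    ∑ i ∈ s, g (σ i) ≤ ∑ k ∈ t, g k := by
  classical
  have h1 : ∑ i ∈ s, g (σ i) = ∑ i ∈ s with σ i ∈ t, g (σ i) := by
    rw [Finset.sum_filter]
    refine Finset.sum_congr rfl fun i hi => ?_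
    split_ifs with h
    · rfl
    · exact hst i hi h
  rw [h1, ← Finset.sum_image (f := g) (g := σ) (fun _ _ _ _ h => hσ h)]
  refine Finset.sum_le_sum_of_subset_of_nonneg ?_ fun k hk _ => hg k hk
  intro k hk
  obtain ⟨i, hi, rfl⟩ := Finset.mem_image.mp hk
  exact (Finset.mem_filter.mp hi).2

/-- The values of `g` on the part `s` of the line, and zero elsewhere. -/
noncomputable def mask (s : Finset ℤ) (g : ℤ → ℝ) (i : ℤ) : ℝ := if i ∈ s then g i else 0

lemma sum_mask_sq_le (s t : Finset ℤ) (g : ℤ → ℝ) {σ : ℤ → ℤ} (hσ : Function.Injective σ) :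
    ∑ i ∈ s, mask t g (σ i) ^ 2 ≤ ∑ k ∈ t, g k ^ 2 := by
  refine (sum_comp_le (g := fun k => mask t g k ^ 2) (t := t) (fun _ _ => sq_nonneg _) σ hσ
    fun i _ hi => by simp [mask, hi]).trans (le_of_eq ?_)
  exact Finset.sum_congr rfl fun k hk => by simp [mask, hk]

/-- The reflection samples `f` at `-i` and `-2i`, both injective in `i`, with `13 = 3² + 2²` from
Cauchy–Schwarz. The margin `5n` contains all sampled points, with room for the difference stencils
even at `n = 1`. -/
lemma sum_reflect_sq_le {n : ℤ} (hn : 0 < n) (f : ℤ → ℝ) :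
    ∑ i ∈ Icc 0 n, reflect f i ^ 2 ≤ 27 * ∑ i ∈ Ioc (-(5 * n)) 0, f i ^ 2 := by
  set t := Ioc (-(5 * n)) 0
  have key : ∀ i ∈ Icc 0 n, reflect f i ^ 2
      ≤ 13 * mask t f (-i) ^ 2 + 13 * mask t f (-(2 * i)) ^ 2 + mask t f i ^ 2 := by
    intro i hi
    rw [Finset.mem_Icc] at hi
    have m1 : mask t f (-i) = f (-i) := if_pos (by simp [t]; omega)
    have m2 : mask t f (-(2 * i)) = f (-(2 * i)) := if_pos (by simp [t]; omega)
    rw [m1, m2, reflect]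
    split_ifs with h
    · have : mask t f i = f i := if_pos (by simp [t]; omega)
      rw [this]; nlinarith [sq_nonneg (f (-i)), sq_nonneg (f (-(2 * i)))]
    · nlinarith [sq_nonneg (2 * f (-i) + 3 * f (-(2 * i))), sq_nonneg (mask t f i)]
  refine (Finset.sum_le_sum key).trans ?_
  rw [Finset.sum_add_distrib, Finset.sum_add_distrib, ← Finset.mul_sum, ← Finset.mul_sum]
  have a1 := sum_mask_sq_le (Icc 0 n) t f (σ := fun i => -i) fun a b h => by simpa using h
  have a2 := sum_mask_sq_le (Icc 0 n) t f (σ := fun i => -(2 * i)) fun a b h => by simpa using h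
  have a3 := sum_mask_sq_le (Icc 0 n) t f (σ := fun i => i) fun a b h => h
  linarith

/-- A step of `f(-2i)` is two lattice steps, so three differences enter with weights `-3, 2, 2`,
whose squares add up to 17. The sum starts at `-1` because second differences at 0 also involve the
backward difference there. -/
lemma sum_reflect_diff_sq_le {n : ℤ} (hn : 0 < n) (f d : ℤ → ℝ)
    (hd : ∀ i ∈ Ico (-(5 * n)) 0, f (i + 1) - f i = d i) :
    ∑ i ∈ Icc (-1) n, (reflect f (i + 1) - reflect f i) ^ 2
      ≤ 52 * ∑ i ∈ Ico (-(5 * n)) 0, d i ^ 2 := by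
  set t := Ico (-(5 * n)) 0
  have key : ∀ i ∈ Icc (-1) n, (reflect f (i + 1) - reflect f i) ^ 2
      ≤ 17 * mask t d (-i - 1) ^ 2 + 17 * mask t d (-(2 * i) - 2) ^ 2
        + 17 * mask t d (-(2 * i) - 1) ^ 2 + mask t d i ^ 2 := by
    intro i hi
    rw [Finset.mem_Icc] at hi
    rcases hi.1.eq_or_lt with rfl | h1
    · have m : mask t d (-1) = d (-1) := if_pos (by simp [t]; omega)
      rw [m, ← hd (-1) (by simp [t]; omega), reflect, reflect, if_pos (by omega), if_pos (by omega)]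
      nlinarith [sq_nonneg (mask t d (-(-1) - 1)), sq_nonneg (mask t d (-(2 * (-1)) - 1)),
        sq_nonneg (mask t d (-(2 * (-1)) - 2))]
    · have m1 : mask t d (-i - 1) = f (-i) - f (-i - 1) := by
        rw [mask, if_pos (by simp [t]; omega), ← hd _ (by simp [t]; omega), sub_add_cancel]
      have m2 : mask t d (-(2 * i) - 2) = f (-(2 * i) - 1) - f (-(2 * i) - 2) := by
        rw [mask, if_pos (by simp [t]; omega), ← hd _ (by simp [t]; omega),
          show -(2 * i) - 2 + 1 = -(2 * i) - 1 by ring]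
      have m3 : mask t d (-(2 * i) - 1) = f (-(2 * i)) - f (-(2 * i) - 1) := by
        rw [mask, if_pos (by simp [t]; omega), ← hd _ (by simp [t]; omega), sub_add_cancel]
      have r1 : reflect f (i + 1) = 3 * f (-i - 1) - 2 * f (-(2 * i) - 2) := by
        rw [reflect, if_neg (by omega), show -(i + 1) = -i - 1 by ring,
          show -(2 * (i + 1)) = -(2 * i) - 2 by ring]
      have r2 : reflect f i = 3 * f (-i) - 2 * f (-(2 * i)) := by
        rw [reflect]
        split_ifs with h
        · obtain rfl : i = 0 := by omega
          norm_num; ring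
        · rfl
      have e : reflect f (i + 1) - reflect f i = -3 * mask t d (-i - 1)
          + 2 * mask t d (-(2 * i) - 2) + 2 * mask t d (-(2 * i) - 1) := by
        rw [r1, r2, m1, m2, m3]; ring
      rw [e]
      generalize mask t d (-i - 1) = x
      generalize mask t d (-(2 * i) - 2) = y
      generalize mask t d (-(2 * i) - 1) = z
      nlinarith [sq_nonneg (2 * x + 3 * y), sq_nonneg (2 * x + 3 * z), sq_nonneg (y - z),
        sq_nonneg (mask t d i)]
  refine (Finset.sum_le_sum key).trans ?_
  rw [Finset.sum_add_distrib, Finset.sum_add_distrib, Finset.sum_add_distrib, ← Finset.mul_sum,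
    ← Finset.mul_sum, ← Finset.mul_sum]
  have a1 := sum_mask_sq_le (Icc (-1) n) t d (σ := fun i => -i - 1) fun a b h => by simpa using h
  have a2 := sum_mask_sq_le (Icc (-1) n) t d (σ := fun i => -(2 * i) - 2)
    fun a b h => by simpa using h
  have a3 := sum_mask_sq_le (Icc (-1) n) t d (σ := fun i => -(2 * i) - 1)
    fun a b h => by simpa using h
  have a4 := sum_mask_sq_le (Icc (-1) n) t d (σ := fun i => i) fun a b h => h
  linarith

lemma sum_reflect_diff2_sq_le {n : ℤ} (hn : 0 < n) (f d : ℤ → ℝ)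
    (hd : ∀ i ∈ Ioo (-(5 * n)) 0, f (i + 1) - 2 * f i + f (i - 1) = d i) :
    ∑ i ∈ Icc 0 n, (reflect f (i + 1) - 2 * reflect f i + reflect f (i - 1)) ^ 2
      ≤ 132 * ∑ i ∈ Ioo (-(5 * n)) 0, d i ^ 2 := by
  set t := Ioo (-(5 * n)) 0
  have key : ∀ i ∈ Icc 0 n, (reflect f (i + 1) - 2 * reflect f i + reflect f (i - 1)) ^ 2
      ≤ 33 * mask t d (-i) ^ 2 + 33 * mask t d (-(2 * i) - 1) ^ 2
        + 33 * mask t d (-(2 * i)) ^ 2 + 33 * mask t d (-(2 * i) + 1) ^ 2 := by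
    intro i hi
    rw [Finset.mem_Icc] at hi
    -- At the junction the second difference equals `-2` times the one of `f` centred at `-1`: this
    -- is where matching of values and slopes is used, and no value of `f` at a positive index
    -- enters.
    rcases hi.1.eq_or_lt with rfl | h1
    · have m : mask t d (-(2 * 0) - 1) = f 0 - 2 * f (-1) + f (-2) := by
        rw [mask, if_pos (by simp [t]; omega), ← hd _ (by simp [t]; omega)]
        norm_num
      have e : reflect f (0 + 1) - 2 * reflect f 0 + reflect f (0 - 1)
          = -2 * mask t d (-(2 * 0) - 1) := by
        rw [m]
        norm_num [reflect]
        ring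
      rw [e]
      nlinarith [sq_nonneg (mask t d (-0)), sq_nonneg (mask t d (-(2 * 0) - 1)),
        sq_nonneg (mask t d (-(2 * 0))), sq_nonneg (mask t d (-(2 * 0) + 1))]
    · have m1 : mask t d (-i) = f (-i + 1) - 2 * f (-i) + f (-i - 1) := by
        rw [mask, if_pos (by simp [t]; omega), ← hd _ (by simp [t]; omega)]
      have m2 : mask t d (-(2 * i) - 1) = f (-(2 * i)) - 2 * f (-(2 * i) - 1) + f (-(2 * i) - 2) := by
        rw [mask, if_pos (by simp [t]; omega), ← hd _ (by simp [t]; omega), sub_add_cancel,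
          show -(2 * i) - 1 - 1 = -(2 * i) - 2 by ring]
      have m3 : mask t d (-(2 * i)) = f (-(2 * i) + 1) - 2 * f (-(2 * i)) + f (-(2 * i) - 1) := by
        rw [mask, if_pos (by simp [t]; omega), ← hd _ (by simp [t]; omega)]
      have m4 : mask t d (-(2 * i) + 1) = f (-(2 * i) + 2) - 2 * f (-(2 * i) + 1) + f (-(2 * i)) := by
        rw [mask, if_pos (by simp [t]; omega), ← hd _ (by simp [t]; omega), add_sub_cancel_right,
          show -(2 * i) + 1 + 1 = -(2 * i) + 2 by ring]
      have r1 : reflect f (i + 1) = 3 * f (-i - 1) - 2 * f (-(2 * i) - 2) := by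
        rw [reflect, if_neg (by omega), show -(i + 1) = -i - 1 by ring,
          show -(2 * (i + 1)) = -(2 * i) - 2 by ring]
      have r2 : reflect f i = 3 * f (-i) - 2 * f (-(2 * i)) := by
        rw [reflect, if_neg (by omega)]
      have r3 : reflect f (i - 1) = 3 * f (-i + 1) - 2 * f (-(2 * i) + 2) := by
        rw [reflect]
        split_ifs with h
        · obtain rfl : i = 1 := by omega
          norm_num; ring
        · rw [show -(i - 1) = -i + 1 by ring, show -(2 * (i - 1)) = -(2 * i) + 2 by ring]
      -- A second difference with step two is a `1, 2, 1` combination of unit ones; the squared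
      -- weights add up to `9 + 4 + 16 + 4 = 33`.
      have e : reflect f (i + 1) - 2 * reflect f i + reflect f (i - 1) = 3 * mask t d (-i)
          - 2 * mask t d (-(2 * i) - 1) - 4 * mask t d (-(2 * i)) - 2 * mask t d (-(2 * i) + 1) := by
        rw [r1, r2, r3, m1, m2, m3, m4]; ring
      rw [e]
      generalize mask t d (-i) = x
      generalize mask t d (-(2 * i) - 1) = y
      generalize mask t d (-(2 * i)) = z
      generalize mask t d (-(2 * i) + 1) = w
      nlinarith [sq_nonneg (2 * x + 3 * y), sq_nonneg (4 * x + 3 * z), sq_nonneg (2 * x + 3 * w),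
        sq_nonneg (4 * y - 2 * z), sq_nonneg (2 * y - 2 * w), sq_nonneg (2 * z - 4 * w)]
  refine (Finset.sum_le_sum key).trans ?_
  rw [Finset.sum_add_distrib, Finset.sum_add_distrib, Finset.sum_add_distrib, ← Finset.mul_sum,
    ← Finset.mul_sum, ← Finset.mul_sum, ← Finset.mul_sum]
  have a1 := sum_mask_sq_le (Icc 0 n) t d (σ := fun i => -i) fun a b h => by simpa using h
  have a2 := sum_mask_sq_le (Icc 0 n) t d (σ := fun i => -(2 * i) - 1)
    fun a b h => by simpa using h
  have a3 := sum_mask_sq_le (Icc 0 n) t d (σ := fun i => -(2 * i))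
    fun a b h => by simpa using h
  have a4 := sum_mask_sq_le (Icc 0 n) t d (σ := fun i => -(2 * i) + 1)
    fun a b h => by simpa using h
  linarith


/-! ### Bounds for the reflection with cutoff -/

lemma sum_halfExt_sq_le {n : ℤ} (hn : 0 < n) (f : ℤ → ℝ) :
    ∑ i ∈ Icc 0 n, halfExt n f i ^ 2 ≤ 27 * ∑ i ∈ Ioc (-(5 * n)) 0, f i ^ 2 := by
  refine le_trans (Finset.sum_le_sum fun i _ => ?_) (sum_reflect_sq_le hn f)
  rw [halfExt, mul_pow]
  have : cutoff n i ^ 2 ≤ 1 := by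
    rw [sq_le_one_iff_abs_le_one]; exact abs_cutoff_le hn
  nlinarith [sq_nonneg (reflect f i)]

lemma mul_sq_le_of_abs_le {a x c : ℝ} (h : |a| ≤ c) : (a * x) ^ 2 ≤ c ^ 2 * x ^ 2 := by
  rw [mul_pow]
  exact mul_le_mul_of_nonneg_right (sq_le_sq.mpr (h.trans (le_abs_self c))) (sq_nonneg x)

lemma sum_halfExt_diff_sq_le {n : ℤ} (hn : 0 < n) (f d : ℤ → ℝ)
    (hd : ∀ i ∈ Ico (-(5 * n)) 0, f (i + 1) - f i = d i) :
    ∑ i ∈ Ico 0 n, (halfExt n f (i + 1) - halfExt n f i) ^ 2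
      ≤ 2000 * (∑ i ∈ Ico (-(5 * n)) 0, d i ^ 2
        + (∑ i ∈ Ioc (-(5 * n)) 0, f i ^ 2) / n ^ 2) := by
  have key : ∀ i ∈ Ico 0 n, (halfExt n f (i + 1) - halfExt n f i) ^ 2
      ≤ 2 * (reflect f (i + 1) - reflect f i) ^ 2 + 72 / n ^ 2 * reflect f i ^ 2 := by
    intro i _
    have e : halfExt n f (i + 1) - halfExt n f i
        = cutoff n (i + 1) * (reflect f (i + 1) - reflect f i)
          + (cutoff n (i + 1) - cutoff n i) * reflect f i := by
      simp only [halfExt]; ring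
    have b1 := mul_sq_le_of_abs_le (x := reflect f (i + 1) - reflect f i)
      (abs_cutoff_le (i := i + 1) hn)
    have b2 := mul_sq_le_of_abs_le (x := reflect f i) (abs_cutoff_diff_le (i := i) hn)
    rw [show (6 / (n : ℝ)) ^ 2 = 36 / n ^ 2 by ring] at b2
    rw [e, show (72 / (n : ℝ) ^ 2) = 2 * (36 / n ^ 2) by ring]
    refine (add_sq_le).trans ?_
    linarith
  refine (Finset.sum_le_sum key).trans ?_
  rw [Finset.sum_add_distrib, ← Finset.mul_sum, ← Finset.mul_sum]
  have r0 := sum_reflect_sq_le hn f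
  have r1 := sum_reflect_diff_sq_le hn f d hd
  have s0 : ∑ i ∈ Ico 0 n, reflect f i ^ 2 ≤ ∑ i ∈ Icc 0 n, reflect f i ^ 2 :=
    Finset.sum_le_sum_of_subset_of_nonneg Ico_subset_Icc_self fun _ _ _ => sq_nonneg _
  have s1 : ∑ i ∈ Ico 0 n, (reflect f (i + 1) - reflect f i) ^ 2
      ≤ ∑ i ∈ Icc (-1) n, (reflect f (i + 1) - reflect f i) ^ 2 :=
    Finset.sum_le_sum_of_subset_of_nonneg
      (fun i hi => by rw [Finset.mem_Ico] at hi; rw [Finset.mem_Icc]; omega)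
      fun _ _ _ => sq_nonneg _
  have hnn : 0 ≤ 72 / (n : ℝ) ^ 2 := by positivity
  have t0 := mul_le_mul_of_nonneg_left (s0.trans r0) hnn
  have z0 : 0 ≤ (∑ i ∈ Ioc (-(5 * n)) 0, f i ^ 2) / (n : ℝ) ^ 2 := by positivity
  have z1 : 0 ≤ ∑ i ∈ Ico (-(5 * n)) 0, d i ^ 2 := by positivity
  have e : 72 / (n : ℝ) ^ 2 * (27 * ∑ i ∈ Ioc (-(5 * n)) 0, f i ^ 2)
      = 1944 * ((∑ i ∈ Ioc (-(5 * n)) 0, f i ^ 2) / n ^ 2) := by ring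
  linarith

lemma sum_halfExt_diff2_sq_le {n : ℤ} (hn : 0 < n) (f d₁ d₂ : ℤ → ℝ)
    (hd₁ : ∀ i ∈ Ico (-(5 * n)) 0, f (i + 1) - f i = d₁ i)
    (hd₂ : ∀ i ∈ Ioo (-(5 * n)) 0, f (i + 1) - 2 * f i + f (i - 1) = d₂ i) :
    ∑ i ∈ Icc 0 n, (halfExt n f (i + 1) - 2 * halfExt n f i + halfExt n f (i - 1)) ^ 2
      ≤ 15000 * (∑ i ∈ Ioo (-(5 * n)) 0, d₂ i ^ 2
        + (∑ i ∈ Ico (-(5 * n)) 0, d₁ i ^ 2) / n ^ 2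
        + (∑ i ∈ Ioc (-(5 * n)) 0, f i ^ 2) / n ^ 4) := by
  have key : ∀ i ∈ Icc 0 n,
      (halfExt n f (i + 1) - 2 * halfExt n f i + halfExt n f (i - 1)) ^ 2
      ≤ 4 * (reflect f (i + 1) - 2 * reflect f i + reflect f (i - 1)) ^ 2
        + 144 / n ^ 2 * (reflect f (i + 1) - reflect f i) ^ 2
        + 144 / n ^ 2 * (reflect f (i - 1 + 1) - reflect f (i - 1)) ^ 2
        + 144 / n ^ 4 * reflect f i ^ 2 := by
    intro i _
    rw [sub_add_cancel]
    -- Discrete Leibniz rule: every difference falling on the cutoff costs a factor `O(1 / n)`.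
    have e : halfExt n f (i + 1) - 2 * halfExt n f i + halfExt n f (i - 1)
        = cutoff n i * (reflect f (i + 1) - 2 * reflect f i + reflect f (i - 1))
          + (cutoff n (i + 1) - cutoff n i) * (reflect f (i + 1) - reflect f i)
          + (cutoff n i - cutoff n (i - 1)) * (reflect f i - reflect f (i - 1))
          + (cutoff n (i + 1) - 2 * cutoff n i + cutoff n (i - 1)) * reflect f i := by
      simp only [halfExt]; ring
    have b1 := mul_sq_le_of_abs_le
      (x := reflect f (i + 1) - 2 * reflect f i + reflect f (i - 1)) (abs_cutoff_le (i := i) hn)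
    have b2 := mul_sq_le_of_abs_le (x := reflect f (i + 1) - reflect f i)
      (abs_cutoff_diff_le (i := i) hn)
    have b3 := mul_sq_le_of_abs_le (x := reflect f i - reflect f (i - 1))
      (abs_cutoff_diff_le (i := i - 1) hn)
    have b4 := mul_sq_le_of_abs_le (x := reflect f i) (abs_cutoff_diff2_le (i := i) hn)
    rw [show (6 / (n : ℝ)) ^ 2 = 36 / n ^ 2 by ring] at b2 b3
    rw [show (6 / (n : ℝ) ^ 2) ^ 2 = 36 / n ^ 4 by ring] at b4
    rw [sub_add_cancel] at b3
    rw [e, show (144 / (n : ℝ) ^ 2) = 4 * (36 / n ^ 2) by ring,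
      show (144 / (n : ℝ) ^ 4) = 4 * (36 / n ^ 4) by ring]
    have four : ∀ x y z w : ℝ, (x + y + z + w) ^ 2 ≤ 4 * (x ^ 2 + y ^ 2 + z ^ 2 + w ^ 2) := by
      intro x y z w
      nlinarith [sq_nonneg (x - y), sq_nonneg (x - z), sq_nonneg (x - w), sq_nonneg (y - z),
        sq_nonneg (y - w), sq_nonneg (z - w)]
    refine (four _ _ _ _).trans ?_
    linarith
  refine (Finset.sum_le_sum key).trans ?_
  rw [Finset.sum_add_distrib, Finset.sum_add_distrib, Finset.sum_add_distrib, ← Finset.mul_sum,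
    ← Finset.mul_sum, ← Finset.mul_sum, ← Finset.mul_sum]
  have r0 := sum_reflect_sq_le hn f
  have r1 := sum_reflect_diff_sq_le hn f d₁ hd₁
  have r2 := sum_reflect_diff2_sq_le hn f d₂ hd₂
  have s1 : ∑ i ∈ Icc 0 n, (reflect f (i + 1) - reflect f i) ^ 2
      ≤ ∑ i ∈ Icc (-1) n, (reflect f (i + 1) - reflect f i) ^ 2 :=
    Finset.sum_le_sum_of_subset_of_nonneg
      (fun i hi => by rw [Finset.mem_Icc] at hi ⊢; omega) fun _ _ _ => sq_nonneg _
  have s2 : ∑ i ∈ Icc 0 n, (reflect f (i - 1 + 1) - reflect f (i - 1)) ^ 2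
      ≤ ∑ i ∈ Icc (-1) n, (reflect f (i + 1) - reflect f i) ^ 2 :=
    sum_comp_le (g := fun i => (reflect f (i + 1) - reflect f i) ^ 2) (fun _ _ => sq_nonneg _)
      (fun i => i - 1) (fun a b h => by simpa using h)
      (fun i hi h => absurd h (by simp only [Finset.mem_Icc] at hi ⊢; omega))
  have hnn : 0 ≤ 144 / (n : ℝ) ^ 2 := by positivity
  have hnn' : 0 ≤ 144 / (n : ℝ) ^ 4 := by positivity
  have t0 := mul_le_mul_of_nonneg_left r0 hnn'
  have t1 := mul_le_mul_of_nonneg_left (s1.trans r1) hnn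
  have t2 := mul_le_mul_of_nonneg_left (s2.trans r1) hnn
  have z0 : 0 ≤ (∑ i ∈ Ioc (-(5 * n)) 0, f i ^ 2) / (n : ℝ) ^ 4 := by positivity
  have z1 : 0 ≤ (∑ i ∈ Ico (-(5 * n)) 0, d₁ i ^ 2) / (n : ℝ) ^ 2 := by positivity
  have z2 : 0 ≤ ∑ i ∈ Ioo (-(5 * n)) 0, d₂ i ^ 2 := by positivity
  have e0 : 144 / (n : ℝ) ^ 4 * (27 * ∑ i ∈ Ioc (-(5 * n)) 0, f i ^ 2)
      = 3888 * ((∑ i ∈ Ioc (-(5 * n)) 0, f i ^ 2) / n ^ 4) := by ring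
  have e1 : 144 / (n : ℝ) ^ 2 * (52 * ∑ i ∈ Ico (-(5 * n)) 0, d₁ i ^ 2)
      = 7488 * ((∑ i ∈ Ico (-(5 * n)) 0, d₁ i ^ 2) / n ^ 2) := by ring
  linarith

/-! ### Bounds for the two-sided extension -/

lemma sum_sq_Ioc_le (n : ℤ) (f : ℤ → ℝ) :
    ∑ i ∈ Ioc (-(5 * n)) 0, f i ^ 2 ≤ ∑ i ∈ Ioo (-(5 * n)) (6 * n), f i ^ 2 :=
  Finset.sum_le_sum_of_subset_of_nonneg
    (fun i hi => by rw [Finset.mem_Ioc] at hi; rw [Finset.mem_Ioo]; omega) fun _ _ _ => sq_nonneg _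

lemma sum_sq_Ioc_flip_le (n : ℤ) (f : ℤ → ℝ) :
    ∑ i ∈ Ioc (-(5 * n)) 0, f (n - i) ^ 2 ≤ ∑ i ∈ Ioo (-(5 * n)) (6 * n), f i ^ 2 :=
  sum_comp_le (g := fun i => f i ^ 2) (fun _ _ => sq_nonneg _) (fun i => n - i)
    (fun a b h => by simpa using h)
    (fun i hi h => absurd h (by simp only [Finset.mem_Ioc] at hi; simp only [Finset.mem_Ioo]; omega))

lemma sum_sq_Ico_le (n : ℤ) (d : ℤ → ℝ) :
    ∑ i ∈ Ico (-(5 * n)) 0, d i ^ 2 ≤ ∑ i ∈ Ico (-(5 * n)) (6 * n), d i ^ 2 :=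
  Finset.sum_le_sum_of_subset_of_nonneg
    (fun i hi => by rw [Finset.mem_Ico] at hi ⊢; omega) fun _ _ _ => sq_nonneg _

lemma sum_sq_Ico_flip_le (n : ℤ) (d : ℤ → ℝ) :
    ∑ i ∈ Ico (-(5 * n)) 0, (-d (n - i - 1)) ^ 2 ≤ ∑ i ∈ Ico (-(5 * n)) (6 * n), d i ^ 2 := by
  simp only [neg_sq]
  exact sum_comp_le (g := fun i => d i ^ 2) (fun _ _ => sq_nonneg _) (fun i => n - i - 1)
    (fun a b h => by simpa using h)
    (fun i hi h => absurd h (by simp only [Finset.mem_Ico] at hi ⊢; omega))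

lemma sum_ext_sq_le {n : ℤ} (hn : 0 < n) (f : ℤ → ℝ) :
    ∑ i ∈ Icc 0 n, ext n f i ^ 2 ≤ 108 * ∑ i ∈ Ioo (-(5 * n)) (6 * n), f i ^ 2 := by
  have h1 := sum_halfExt_sq_le hn f
  have h2 := sum_halfExt_sq_le hn fun k => f (n - k)
  have h3 : ∑ i ∈ Icc 0 n, halfExt n (fun k => f (n - k)) (n - i) ^ 2
      ≤ ∑ i ∈ Icc 0 n, halfExt n (fun k => f (n - k)) i ^ 2 :=
    sum_comp_le (g := fun i => halfExt n (fun k => f (n - k)) i ^ 2) (fun _ _ => sq_nonneg _)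
      (fun i => n - i) (fun a b h => by simpa using h)
      (fun i hi h => absurd h (by simp only [Finset.mem_Icc] at hi ⊢; omega))
  have s1 := sum_sq_Ioc_le n f
  have s2 := sum_sq_Ioc_flip_le n f
  calc ∑ i ∈ Icc 0 n, ext n f i ^ 2
      ≤ ∑ i ∈ Icc 0 n, (2 * halfExt n f i ^ 2
        + 2 * halfExt n (fun k => f (n - k)) (n - i) ^ 2) :=
        Finset.sum_le_sum fun i _ => add_sq_le.trans (by linarith)
    _ ≤ _ := by
      rw [Finset.sum_add_distrib, ← Finset.mul_sum, ← Finset.mul_sum]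
      linarith

lemma sum_ext_diff_sq_le {n : ℤ} (hn : 0 < n) (f d : ℤ → ℝ)
    (hd : ∀ i, -(5 * n) ≤ i → i < 6 * n → (i < 0 ∨ n ≤ i) → f (i + 1) - f i = d i) :
    ∑ i ∈ Ico 0 n, (ext n f (i + 1) - ext n f i) ^ 2
      ≤ 8000 * (∑ i ∈ Ico (-(5 * n)) (6 * n), d i ^ 2
        + (∑ i ∈ Ioo (-(5 * n)) (6 * n), f i ^ 2) / n ^ 2) := by
  have h1 := sum_halfExt_diff_sq_le hn f d fun i hi => by
    rw [Finset.mem_Ico] at hi; exact hd i (by omega) (by omega) (Or.inl (by omega))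
  have h2 := sum_halfExt_diff_sq_le hn (fun k => f (n - k)) (fun k => -d (n - k - 1)) fun i hi => by
    rw [Finset.mem_Ico] at hi
    rw [← hd (n - i - 1) (by omega) (by omega) (Or.inr (by omega)), sub_add_cancel,
      show n - (i + 1) = n - i - 1 by ring]
    ring
  have h3 : ∑ i ∈ Ico 0 n, (halfExt n (fun k => f (n - k)) (n - 1 - i + 1)
        - halfExt n (fun k => f (n - k)) (n - 1 - i)) ^ 2
      ≤ ∑ i ∈ Ico 0 n, (halfExt n (fun k => f (n - k)) (i + 1)
        - halfExt n (fun k => f (n - k)) i) ^ 2 :=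
    sum_comp_le (g := fun i => (halfExt n (fun k => f (n - k)) (i + 1)
        - halfExt n (fun k => f (n - k)) i) ^ 2) (fun _ _ => sq_nonneg _)
      (fun i => n - 1 - i) (fun a b h => by simpa using h)
      (fun i hi h => absurd h (by simp only [Finset.mem_Ico] at hi ⊢; omega))
  have s1 := sum_sq_Ioc_le n f
  have s2 := sum_sq_Ioc_flip_le n f
  have s3 := sum_sq_Ico_le n d
  have s4 := sum_sq_Ico_flip_le n d
  have hnn : 0 ≤ (n : ℝ) ^ 2 := by positivity
  have s1' := div_le_div_of_nonneg_right s1 hnn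
  have s2' := div_le_div_of_nonneg_right s2 hnn
  calc ∑ i ∈ Ico 0 n, (ext n f (i + 1) - ext n f i) ^ 2
      ≤ ∑ i ∈ Ico 0 n, (2 * (halfExt n f (i + 1) - halfExt n f i) ^ 2
        + 2 * (halfExt n (fun k => f (n - k)) (n - 1 - i + 1)
        - halfExt n (fun k => f (n - k)) (n - 1 - i)) ^ 2) := by
        refine Finset.sum_le_sum fun i _ => ?_
        rw [ext, ext, show n - 1 - i + 1 = n - i by ring, show n - (i + 1) = n - 1 - i by ring]
        generalize halfExt n f (i + 1) = a
        generalize halfExt n f i = b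
        generalize halfExt n (fun k => f (n - k)) (n - i) = c
        generalize halfExt n (fun k => f (n - k)) (n - 1 - i) = e
        nlinarith [sq_nonneg ((a - b) + (c - e))]
    _ ≤ _ := by
      rw [Finset.sum_add_distrib, ← Finset.mul_sum, ← Finset.mul_sum]
      linarith

/-- The two halves are mirror images under `i ↦ n - i`. Adding them costs a factor 2, and bounding
each by sums over the long interval another 2, whence `60000 = 4 * 15000`. -/
lemma sum_ext_diff2_sq_le {n : ℤ} (hn : 0 < n) (f d₁ d₂ : ℤ → ℝ)
    (hd₁ : ∀ i, -(5 * n) ≤ i → i < 6 * n → (i < 0 ∨ n ≤ i) → f (i + 1) - f i = d₁ i)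
    (hd₂ : ∀ i, -(5 * n) < i → i < 6 * n → (i < 0 ∨ n < i) →
      f (i + 1) - 2 * f i + f (i - 1) = d₂ i) :
    ∑ i ∈ Icc 0 n, (ext n f (i + 1) - 2 * ext n f i + ext n f (i - 1)) ^ 2
      ≤ 60000 * (∑ i ∈ Ioo (-(5 * n)) (6 * n), d₂ i ^ 2
        + (∑ i ∈ Ico (-(5 * n)) (6 * n), d₁ i ^ 2) / n ^ 2
        + (∑ i ∈ Ioo (-(5 * n)) (6 * n), f i ^ 2) / n ^ 4) := by
  have h1 := sum_halfExt_diff2_sq_le hn f d₁ d₂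
    (fun i hi => by
      rw [Finset.mem_Ico] at hi; exact hd₁ i (by omega) (by omega) (Or.inl (by omega)))
    (fun i hi => by
      rw [Finset.mem_Ioo] at hi; exact hd₂ i (by omega) (by omega) (Or.inl (by omega)))
  have h2 := sum_halfExt_diff2_sq_le hn (fun k => f (n - k)) (fun k => -d₁ (n - k - 1))
    (fun k => d₂ (n - k))
    (fun i hi => by
      rw [Finset.mem_Ico] at hi
      rw [← hd₁ (n - i - 1) (by omega) (by omega) (Or.inr (by omega)), sub_add_cancel,
        show n - (i + 1) = n - i - 1 by ring]
      ring)
    (fun i hi => by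
      rw [Finset.mem_Ioo] at hi
      rw [← hd₂ (n - i) (by omega) (by omega) (Or.inr (by omega)),
        show n - (i + 1) = n - i - 1 by ring, show n - (i - 1) = n - i + 1 by ring]
      ring)
  set g := halfExt n fun k => f (n - k)
  have h3 : ∑ i ∈ Icc 0 n, (g (n - i + 1) - 2 * g (n - i) + g (n - i - 1)) ^ 2
      ≤ ∑ i ∈ Icc 0 n, (g (i + 1) - 2 * g i + g (i - 1)) ^ 2 :=
    sum_comp_le (g := fun i => (g (i + 1) - 2 * g i + g (i - 1)) ^ 2) (fun _ _ => sq_nonneg _)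
      (fun i => n - i) (fun a b h => by simpa using h)
      (fun i hi h => absurd h (by simp only [Finset.mem_Icc] at hi ⊢; omega))
  have s1 := sum_sq_Ioc_le n f
  have s2 := sum_sq_Ioc_flip_le n f
  have s3 := sum_sq_Ico_le n d₁
  have s4 := sum_sq_Ico_flip_le n d₁
  have s5 : ∑ i ∈ Ioo (-(5 * n)) 0, d₂ i ^ 2 ≤ ∑ i ∈ Ioo (-(5 * n)) (6 * n), d₂ i ^ 2 :=
    Finset.sum_le_sum_of_subset_of_nonneg
      (fun i hi => by rw [Finset.mem_Ioo] at hi ⊢; omega) fun _ _ _ => sq_nonneg _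
  have s6 : ∑ i ∈ Ioo (-(5 * n)) 0, d₂ (n - i) ^ 2 ≤ ∑ i ∈ Ioo (-(5 * n)) (6 * n), d₂ i ^ 2 :=
    sum_comp_le (g := fun i => d₂ i ^ 2) (fun _ _ => sq_nonneg _) (fun i => n - i)
      (fun a b h => by simpa using h)
      (fun i hi h => absurd h (by simp only [Finset.mem_Ioo] at hi ⊢; omega))
  have hnn : 0 ≤ (n : ℝ) ^ 2 := by positivity
  have hnn' : 0 ≤ (n : ℝ) ^ 4 := by positivity
  have s1' := div_le_div_of_nonneg_right s1 hnn'
  have s2' := div_le_div_of_nonneg_right s2 hnn'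
  have s3' := div_le_div_of_nonneg_right s3 hnn
  have s4' := div_le_div_of_nonneg_right s4 hnn
  calc ∑ i ∈ Icc 0 n, (ext n f (i + 1) - 2 * ext n f i + ext n f (i - 1)) ^ 2
      ≤ ∑ i ∈ Icc 0 n, (2 * (halfExt n f (i + 1) - 2 * halfExt n f i + halfExt n f (i - 1)) ^ 2
        + 2 * (g (n - i + 1) - 2 * g (n - i) + g (n - i - 1)) ^ 2) := by
        refine Finset.sum_le_sum fun i _ => ?_
        rw [ext, ext, ext, show n - (i + 1) = n - i - 1 by ring,
          show n - (i - 1) = n - i + 1 by ring]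
        set a := halfExt n f (i + 1) - 2 * halfExt n f i + halfExt n f (i - 1) with ha
        have e : halfExt n f (i + 1) + g (n - i - 1) - 2 * (halfExt n f i + g (n - i))
            + (halfExt n f (i - 1) + g (n - i + 1))
            = a + (g (n - i + 1) - 2 * g (n - i) + g (n - i - 1)) := by rw [ha]; ring
        rw [e]
        exact add_sq_le.trans (by linarith)
    _ ≤ _ := by
      rw [Finset.sum_add_distrib, ← Finset.mul_sum, ← Finset.mul_sum]
      linarith


/-! ### Correction of a velocity on a line -/

lemma sum_sub_ext_sq_le {n : ℤ} (hn : 0 < n) (f : ℤ → ℝ) :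
    ∑ i ∈ Icc 0 n, (f i - ext n f i) ^ 2 ≤ 218 * ∑ i ∈ Ioo (-(5 * n)) (6 * n), f i ^ 2 := by
  have h1 := sum_ext_sq_le hn f
  have h2 : ∑ i ∈ Icc 0 n, f i ^ 2 ≤ ∑ i ∈ Ioo (-(5 * n)) (6 * n), f i ^ 2 :=
    Finset.sum_le_sum_of_subset_of_nonneg
      (fun i hi => by rw [Finset.mem_Icc] at hi; rw [Finset.mem_Ioo]; omega)
      fun _ _ _ => sq_nonneg _
  have h3 : ∑ i ∈ Icc 0 n, (f i - ext n f i) ^ 2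
      ≤ ∑ i ∈ Icc 0 n, (2 * f i ^ 2 + 2 * ext n f i ^ 2) :=
    Finset.sum_le_sum fun i _ => by nlinarith [sq_nonneg (f i + ext n f i)]
  rw [Finset.sum_add_distrib, ← Finset.mul_sum, ← Finset.mul_sum] at h3
  linarith

lemma sum_sub_ext_diff_sq_le {n : ℤ} (hn : 0 < n) (f : ℤ → ℝ) :
    ∑ i ∈ Ico 0 n, ((f (i + 1) - ext n f (i + 1)) - (f i - ext n f i)) ^ 2
      ≤ 16002 * (∑ i ∈ Ico (-(5 * n)) (6 * n), (f (i + 1) - f i) ^ 2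
        + (∑ i ∈ Ioo (-(5 * n)) (6 * n), f i ^ 2) / n ^ 2) := by
  have h1 := sum_ext_diff_sq_le hn f (fun i => f (i + 1) - f i) fun _ _ _ _ => rfl
  have h2 : ∑ i ∈ Ico 0 n, (f (i + 1) - f i) ^ 2
      ≤ ∑ i ∈ Ico (-(5 * n)) (6 * n), (f (i + 1) - f i) ^ 2 :=
    Finset.sum_le_sum_of_subset_of_nonneg
      (fun i hi => by rw [Finset.mem_Ico] at hi ⊢; omega) fun _ _ _ => sq_nonneg _
  have h3 : ∑ i ∈ Ico 0 n, ((f (i + 1) - ext n f (i + 1)) - (f i - ext n f i)) ^ 2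
      ≤ ∑ i ∈ Ico 0 n, (2 * (f (i + 1) - f i) ^ 2 + 2 * (ext n f (i + 1) - ext n f i) ^ 2) :=
    Finset.sum_le_sum fun i _ => by
      nlinarith [sq_nonneg ((f (i + 1) - f i) + (ext n f (i + 1) - ext n f i))]
  rw [Finset.sum_add_distrib, ← Finset.mul_sum, ← Finset.mul_sum] at h3
  have z : 0 ≤ (∑ i ∈ Ioo (-(5 * n)) (6 * n), f i ^ 2) / (n : ℝ) ^ 2 := by positivity
  linarith

/-- Here `f` is a stream function of `w`, valid only outside the interval. The extension uses only
outer values of `f`, so its second differences are controlled by differences of `w` and by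
lower-order terms. -/
lemma sum_add_ext_diff_sq_le {n : ℤ} (hn : 0 < n) (f w : ℤ → ℝ)
    (hf : ∀ i, -(5 * n) ≤ i → i < 6 * n → (i < 0 ∨ n ≤ i) → f (i + 1) - f i = -w i) :
    ∑ i ∈ Icc 0 n, ((w i + (ext n f (i + 1) - ext n f i))
        - (w (i - 1) + (ext n f i - ext n f (i - 1)))) ^ 2
      ≤ 120002 * (∑ i ∈ Ioo (-(5 * n)) (6 * n), (w i - w (i - 1)) ^ 2
        + (∑ i ∈ Ico (-(5 * n)) (6 * n), w i ^ 2) / n ^ 2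
        + (∑ i ∈ Ioo (-(5 * n)) (6 * n), f i ^ 2) / n ^ 4) := by
  have h1 := sum_ext_diff2_sq_le hn f (fun i => -w i) (fun i => -(w i - w (i - 1))) hf
    fun i h1 h2 h3 => by
      have a := hf i (by omega) (by omega) (by omega)
      have b := hf (i - 1) (by omega) (by omega) (by omega)
      rw [sub_add_cancel] at b
      linarith
  simp only [neg_sq] at h1
  have h2 : ∑ i ∈ Icc 0 n, (w i - w (i - 1)) ^ 2
      ≤ ∑ i ∈ Ioo (-(5 * n)) (6 * n), (w i - w (i - 1)) ^ 2 :=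
    Finset.sum_le_sum_of_subset_of_nonneg
      (fun i hi => by rw [Finset.mem_Icc] at hi; rw [Finset.mem_Ioo]; omega)
      fun _ _ _ => sq_nonneg _
  have h3 : ∑ i ∈ Icc 0 n, ((w i + (ext n f (i + 1) - ext n f i))
        - (w (i - 1) + (ext n f i - ext n f (i - 1)))) ^ 2
      ≤ ∑ i ∈ Icc 0 n, (2 * (w i - w (i - 1)) ^ 2
        + 2 * (ext n f (i + 1) - 2 * ext n f i + ext n f (i - 1)) ^ 2) :=
    Finset.sum_le_sum fun i _ => by
      nlinarith [sq_nonneg ((w i - w (i - 1)) - (ext n f (i + 1) - 2 * ext n f i + ext n f (i - 1)))]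
  rw [Finset.sum_add_distrib, ← Finset.mul_sum, ← Finset.mul_sum] at h3
  have z1 : 0 ≤ (∑ i ∈ Ioo (-(5 * n)) (6 * n), f i ^ 2) / (n : ℝ) ^ 4 := by positivity
  have z2 : 0 ≤ (∑ i ∈ Ico (-(5 * n)) (6 * n), w i ^ 2) / (n : ℝ) ^ 2 := by positivity
  linarith

/-! ### Partial sums and the discrete Poincaré inequality -/

lemma sum_Ico_add_one {a i : ℤ} (hi : a ≤ i) (g : ℤ → ℝ) :
    ∑ k ∈ Ico a (i + 1), g k = ∑ k ∈ Ico a i, g k + g i := by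
  have : Ico a (i + 1) = insert i (Ico a i) := by
    ext k; rw [Finset.mem_insert, Finset.mem_Ico, Finset.mem_Ico]; omega
  rw [this, Finset.sum_insert (by simp), add_comm]

lemma sum_Ico_diff {a i : ℤ} (hi : a ≤ i) (f : ℤ → ℝ) :
    ∑ k ∈ Ico a i, (f (k + 1) - f k) = f i - f a := by
  induction i, hi using Int.leInduction with
  | base => simp
  | succ i hi ih => rw [sum_Ico_add_one hi, ih]; ring

/-- Each value is the telescoping sum of at most `b - a` differences; Cauchy–Schwarz gives one
factor of the length, summation over `i` the other. -/
lemma sum_sq_le_of_eq_zero {a b : ℤ} (f : ℤ → ℝ) (ha : f a = 0) :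
    ∑ i ∈ Ico a b, f i ^ 2 ≤ (b - a : ℝ) ^ 2 * ∑ i ∈ Ico a b, (f (i + 1) - f i) ^ 2 := by
  rcases lt_or_ge b a with hab | hab
  · rw [Finset.Ico_eq_empty (by omega)]; simp
  have hcard : ∀ i, a ≤ i → ((Ico a i).card : ℝ) = i - a := by
    intro i hi
    have : ((Ico a i).card : ℤ) = i - a := by rw [Int.card_Ico, Int.toNat_of_nonneg (by omega)]
    exact_mod_cast this
  have hba : (0 : ℝ) ≤ b - a := by rw [← hcard b hab]; positivity
  have key : ∀ i ∈ Ico a b, f i ^ 2 ≤ (b - a : ℝ) * ∑ i ∈ Ico a b, (f (i + 1) - f i) ^ 2 := by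
    intro i hi
    rw [Finset.mem_Ico] at hi
    have h1 := sum_Ico_diff hi.1 f
    rw [ha, sub_zero] at h1
    rw [← h1]
    refine sq_sum_le_card_mul_sum_sq.trans ?_
    refine mul_le_mul ?_ ?_ (Finset.sum_nonneg fun _ _ => sq_nonneg _) hba
    · rw [hcard i hi.1]
      have : (i : ℝ) ≤ b := by exact_mod_cast hi.2.le
      linarith
    · exact Finset.sum_le_sum_of_subset_of_nonneg (Finset.Ico_subset_Ico_right hi.2.le)
        fun _ _ _ => sq_nonneg _
  refine (Finset.sum_le_card_nsmul _ _ _ key).trans (le_of_eq ?_)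
  rw [nsmul_eq_mul, hcard b hab]
  ring

lemma sum_sum_sq_le {s t s' t' : Finset ℤ} (hs : s ⊆ s') (ht : t ⊆ t') (f : ℤ → ℤ → ℝ) :
    ∑ i ∈ s, ∑ j ∈ t, f i j ^ 2 ≤ ∑ i ∈ s', ∑ j ∈ t', f i j ^ 2 :=
  (Finset.sum_le_sum fun _ _ =>
    Finset.sum_le_sum_of_subset_of_nonneg ht fun _ _ _ => sq_nonneg _).trans
  (Finset.sum_le_sum_of_subset_of_nonneg hs fun _ _ _ =>
    Finset.sum_nonneg fun _ _ => sq_nonneg _)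


/-! ### Correction of a velocity in the plane -/

section lines

variable {ι : Type*} {T : Finset ι} {n : ℤ} {A B C : ℝ}

lemma sum_lines_sub_ext_sq_le (hn : 0 < n) (f : ι → ℤ → ℝ)
    (hA : ∑ j ∈ T, ∑ i ∈ Ioo (-(5 * n)) (6 * n), f j i ^ 2 ≤ A) :
    ∑ j ∈ T, ∑ i ∈ Icc 0 n, (f j i - ext n (f j) i) ^ 2 ≤ 218 * A := by
  refine (Finset.sum_le_sum fun j _ => sum_sub_ext_sq_le hn (f j)).trans ?_
  rw [← Finset.mul_sum]
  linarith

/-- `B` is normalized by `n ^ 2` because the Poincaré inequality supplies that factor; it cancels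
the `1 / n ^ 2` from the cutoff and leaves a grid-independent bound. -/
lemma sum_lines_sub_ext_diff_sq_le (hn : 0 < n) (f : ι → ℤ → ℝ)
    (hA : ∑ j ∈ T, ∑ i ∈ Ico (-(5 * n)) (6 * n), (f j (i + 1) - f j i) ^ 2 ≤ A)
    (hB : ∑ j ∈ T, ∑ i ∈ Ioo (-(5 * n)) (6 * n), f j i ^ 2 ≤ B * n ^ 2) :
    ∑ j ∈ T, ∑ i ∈ Ico 0 n, ((f j (i + 1) - ext n (f j) (i + 1)) - (f j i - ext n (f j) i)) ^ 2
      ≤ 16002 * (A + B) := by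
  refine (Finset.sum_le_sum fun j _ => sum_sub_ext_diff_sq_le hn (f j)).trans ?_
  have hn' : (0 : ℝ) < n := by exact_mod_cast hn
  rw [← Finset.mul_sum, Finset.sum_add_distrib, ← Finset.sum_div]
  have := (div_le_iff₀ (by positivity : (0 : ℝ) < n ^ 2)).mpr hB
  linarith

lemma sum_lines_add_ext_diff_sq_le (hn : 0 < n) (f w : ι → ℤ → ℝ)
    (hf : ∀ j ∈ T, ∀ i, -(5 * n) ≤ i → i < 6 * n → (i < 0 ∨ n ≤ i) →
      f j (i + 1) - f j i = -w j i)
    (hA : ∑ j ∈ T, ∑ i ∈ Ioo (-(5 * n)) (6 * n), (w j i - w j (i - 1)) ^ 2 ≤ A)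
    (hB : ∑ j ∈ T, ∑ i ∈ Ico (-(5 * n)) (6 * n), w j i ^ 2 ≤ B * n ^ 2)
    (hC : ∑ j ∈ T, ∑ i ∈ Ioo (-(5 * n)) (6 * n), f j i ^ 2 ≤ C * n ^ 4) :
    ∑ j ∈ T, ∑ i ∈ Icc 0 n, ((w j i + (ext n (f j) (i + 1) - ext n (f j) i))
        - (w j (i - 1) + (ext n (f j) i - ext n (f j) (i - 1)))) ^ 2
      ≤ 120002 * (A + B + C) := by
  refine (Finset.sum_le_sum fun j hj =>
    sum_add_ext_diff_sq_le hn (f j) (w j) (hf j hj)).trans ?_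
  have hn' : (0 : ℝ) < n := by exact_mod_cast hn
  rw [← Finset.mul_sum, Finset.sum_add_distrib, Finset.sum_add_distrib, ← Finset.sum_div,
    ← Finset.sum_div]
  have h1 := (div_le_iff₀ (by positivity : (0 : ℝ) < n ^ 2)).mpr hB
  have h2 := (div_le_iff₀ (by positivity : (0 : ℝ) < n ^ 4)).mpr hC
  linarith

lemma sum_lines_sq_le_of_eq_zero {a b : ℤ} (f : ι → ℤ → ℝ) (ha : ∀ j ∈ T, f j a = 0)
    (hA : ∑ j ∈ T, ∑ i ∈ Ico a b, (f j (i + 1) - f j i) ^ 2 ≤ A) :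
    ∑ j ∈ T, ∑ i ∈ Ico a b, f j i ^ 2 ≤ (b - a : ℝ) ^ 2 * A := by
  refine (Finset.sum_le_sum fun j hj => sum_sq_le_of_eq_zero (f j) (ha j hj)).trans ?_
  rw [← Finset.mul_sum]
  exact mul_le_mul_of_nonneg_left hA (sq_nonneg _)

end lines

/-- First correction: the velocity is made to vanish outside `0 < x < n`. -/
lemma exists_correction_x {n m : ℤ} (hn : 0 < n) (hm : 0 < m) {κ Q : ℝ} (hκ : (m : ℝ) ≤ κ * n)
    (hQ : 0 ≤ Q) (q u v : ℤ → ℤ → ℝ)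
    (hq : ∀ i j, ¬(0 ≤ i ∧ i < n ∧ 0 ≤ j ∧ j < m) → q i j = 0)
    (hu : ∀ j, u (-(5 * n)) j = 0) (hv : ∀ i, v i (-(5 * m)) = 0)
    (hdiv : ∀ i ∈ Ico (-(5 * n)) (6 * n), ∀ j ∈ Ico (-(5 * m)) (6 * m),
      u (i + 1) j - u i j + (v i (j + 1) - v i j) = q i j)
    (hux : ∑ j ∈ Ico (-(5 * m)) (6 * m), ∑ i ∈ Ico (-(5 * n)) (6 * n),
      (u (i + 1) j - u i j) ^ 2 ≤ Q)
    (huy : ∑ j ∈ Ioo (-(5 * m)) (6 * m), ∑ i ∈ Ioo (-(5 * n)) (6 * n),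
      (u i j - u i (j - 1)) ^ 2 ≤ Q)
    (hvx : ∑ j ∈ Ioo (-(5 * m)) (6 * m), ∑ i ∈ Ioo (-(5 * n)) (6 * n),
      (v i j - v (i - 1) j) ^ 2 ≤ Q)
    (hvy : ∑ j ∈ Ico (-(5 * m)) (6 * m), ∑ i ∈ Ico (-(5 * n)) (6 * n),
      (v i (j + 1) - v i j) ^ 2 ≤ Q) :
    ∃ u' v' : ℤ → ℤ → ℝ,
      (∀ j, u' 0 j = 0 ∧ u' n j = 0) ∧
      (∀ j, -(5 * m) ≤ j → j ≤ 6 * m → v' (-1) j = 0 ∧ v' n j = 0) ∧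
      (∀ i, 0 ≤ i → i < n → v' i (-(5 * m)) = 0) ∧
      (∀ i ∈ Ico 0 n, ∀ j ∈ Ico (-(5 * m)) (6 * m),
        u' (i + 1) j - u' i j + (v' i (j + 1) - v' i j) = q i j) ∧
      ∑ j ∈ Ico (-(5 * m)) (6 * m), ∑ i ∈ Ico 0 n, (u' (i + 1) j - u' i j) ^ 2
        ≤ 2 * 10 ^ 9 * (1 + κ ^ 2) * Q ∧
      ∑ j ∈ Ioo (-(5 * m)) (6 * m), ∑ i ∈ Icc 0 n, (u' i j - u' i (j - 1)) ^ 2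
        ≤ 2 * 10 ^ 9 * (1 + κ ^ 2) * Q ∧
      ∑ j ∈ Ioo (-(5 * m)) (6 * m), ∑ i ∈ Icc 0 n, (v' i j - v' (i - 1) j) ^ 2
        ≤ 2 * 10 ^ 9 * (1 + κ ^ 2) * Q := by
  have hn' : (0 : ℝ) < n := by exact_mod_cast hn
  have hm' : (0 : ℝ) < m := by exact_mod_cast hm
  have hκ2 : (m : ℝ) ^ 2 ≤ κ ^ 2 * n ^ 2 := by
    rw [← mul_pow]; exact pow_le_pow_left₀ hm'.le hκ 2
  -- A stream function with vertical difference `u` everywhere above the bottom. Its horizontal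
  -- difference is `-v` only where the divergence vanishes, in particular in the strips left and
  -- right of the rectangle.
  let ψ : ℤ → ℤ → ℝ := fun i j => ∑ k ∈ Ico (-(5 * m)) j, u i k
  have hψ0 : ∀ i, ψ i (-(5 * m)) = 0 := fun i => by simp [ψ]
  have hψy : ∀ i j, -(5 * m) ≤ j → ψ i (j + 1) - ψ i j = u i j := fun i j hj => by
    simp only [ψ]; rw [sum_Ico_add_one hj]; ring
  have hψx : ∀ i, -(5 * n) ≤ i → i < 6 * n → (i < 0 ∨ n ≤ i) → ∀ j, -(5 * m) ≤ j → j ≤ 6 * m →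
      ψ (i + 1) j - ψ i j = -v i j := by
    intro i h1 h2 h3 j h4
    induction j, h4 using Int.leInduction with
    | base => intro _; rw [hψ0, hψ0, hv]; ring
    | succ j h4 ih =>
      intro h5
      have a := hψy (i + 1) j h4
      have b := hψy i j h4
      have c := hdiv i (Finset.mem_Ico.mpr ⟨h1, h2⟩) j (Finset.mem_Ico.mpr ⟨h4, by omega⟩)
      rw [hq i j (by omega)] at c
      have := ih (by omega)
      linarith
  -- Subtracting the divergence-free field `(F_y, -F_x)` leaves the divergence unchanged and
  -- annihilates the velocity where `F = ψ`. By linearity `F_y` is just the extension of `u`.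
  let F : ℤ → ℤ → ℝ := fun i j => ext n (fun k => ψ k j) i
  have hFo : ∀ i j, (i ≤ 0 ∨ n ≤ i) → F i j = ψ i j := fun i j hi => ext_of_outer hn _ hi
  have hFy : ∀ i j, -(5 * m) ≤ j → F i (j + 1) - F i j = ext n (fun k => u k j) i := by
    intro i j hj
    simp only [F]
    rw [← ext_sub]
    congr 1
    ext k
    exact hψy k j hj
  have sX : Ioo (-(5 * n)) (6 * n) ⊆ Ico (-(5 * n)) (6 * n) := Ioo_subset_Ico_self
  have sY : Ioo (-(5 * m)) (6 * m) ⊆ Ico (-(5 * m)) (6 * m) := Ioo_subset_Ico_self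
  have hu2 : ∑ j ∈ Ico (-(5 * m)) (6 * m), ∑ i ∈ Ico (-(5 * n)) (6 * n), u i j ^ 2
      ≤ 121 * n ^ 2 * Q := by
    refine (sum_lines_sq_le_of_eq_zero (fun j i => u i j) (fun j _ => hu j) hux).trans
      (le_of_eq ?_)
    push_cast; ring
  have hv2 : ∑ j ∈ Ico (-(5 * m)) (6 * m), ∑ i ∈ Ico (-(5 * n)) (6 * n), v i j ^ 2
      ≤ 121 * m ^ 2 * Q := by
    rw [Finset.sum_comm] at hvy ⊢
    refine (sum_lines_sq_le_of_eq_zero (fun i j => v i j) (fun i _ => hv i) hvy).trans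
      (le_of_eq ?_)
    push_cast; ring
  have hψ2 : ∑ j ∈ Ico (-(5 * m)) (6 * m), ∑ i ∈ Ico (-(5 * n)) (6 * n), ψ i j ^ 2
      ≤ 121 * m ^ 2 * (121 * n ^ 2 * Q) := by
    rw [Finset.sum_comm] at hu2 ⊢
    refine (sum_lines_sq_le_of_eq_zero (A := 121 * n ^ 2 * Q) (fun i j => ψ i j)
      (fun i _ => hψ0 i) ?_).trans (le_of_eq ?_)
    · refine le_trans (le_of_eq ?_) hu2
      refine Finset.sum_congr rfl fun i _ => Finset.sum_congr rfl fun j hj => ?_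
      rw [Finset.mem_Ico] at hj
      rw [hψy i j hj.1]
    · push_cast; ring
  have hκQ : 0 ≤ κ ^ 2 * Q := by positivity
  refine ⟨fun i j => u i j - ext n (fun k => u k j) i, fun i j => v i j + (F (i + 1) j - F i j),
    ?_, ?_, ?_, ?_, ?_, ?_, ?_⟩
  · intro j
    simp only
    rw [ext_of_outer hn _ (Or.inl le_rfl), ext_of_outer hn _ (Or.inr le_rfl)]
    simp
  · intro j h1 h2
    simp only
    have a := hψx (-1) (by omega) (by omega) (by omega) j h1 h2
    have b := hψx n (by omega) (by omega) (by omega) j h1 h2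
    rw [hFo _ _ (by omega), hFo _ _ (by omega), hFo _ _ (by omega), hFo _ _ (by omega), a, b]
    simp
  · intro i _ _
    simp only [F, hψ0, ext_zero, hv]
    simp
  · intro i hi j hj
    rw [Finset.mem_Ico] at hi
    have hj' := Finset.mem_Ico.mp hj
    have a := hFy i j hj'.1
    have b := hFy (i + 1) j hj'.1
    have c := hdiv i (Finset.mem_Ico.mpr ⟨by omega, by omega⟩) j hj
    simp only
    linarith
  · refine (sum_lines_sub_ext_diff_sq_le (B := 121 * Q) hn (fun j i => u i j) hux ?_).trans ?_
    · refine (sum_sum_sq_le (Subset.refl _) sX fun j i => u i j).trans (hu2.trans (le_of_eq ?_))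
      ring
    · nlinarith
  · have e : ∀ i j, (u i j - ext n (fun k => u k j) i)
        - (u i (j - 1) - ext n (fun k => u k (j - 1)) i)
        = (u i j - u i (j - 1)) - ext n (fun k => u k j - u k (j - 1)) i := by
      intro i j; rw [ext_sub n (fun k => u k j) fun k => u k (j - 1)]; ring
    simp only [e]
    refine (sum_lines_sub_ext_sq_le hn (fun j i => u i j - u i (j - 1)) huy).trans ?_
    nlinarith
  · simp only [sub_add_cancel]
    -- One Poincaré inequality over length `11m` gives `121 = 11 ^ 2` for `v`; two of them, over
    -- `11m` and `11n`, give `14641 = 11 ^ 4` for `ψ`. The aspect ratio converts `m` into `n`.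
    refine (sum_lines_add_ext_diff_sq_le (B := 121 * κ ^ 2 * Q) (C := 14641 * κ ^ 2 * Q) hn
      (fun j i => ψ i j) (fun j i => v i j) ?_ hvx ?_ ?_).trans ?_
    · intro j hj i h1 h2 h3
      rw [Finset.mem_Ioo] at hj
      exact hψx i h1 h2 h3 j hj.1.le hj.2.le
    · refine (sum_sum_sq_le sY (Subset.refl _) fun j i => v i j).trans (hv2.trans ?_)
      nlinarith [mul_le_mul_of_nonneg_right hκ2 hQ]
    · refine (sum_sum_sq_le sY sX fun j i => ψ i j).trans (hψ2.trans ?_)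
      have : 0 ≤ (n : ℝ) ^ 2 * Q := by positivity
      nlinarith [mul_le_mul_of_nonneg_right hκ2 this]
    · nlinarith

/-- Second correction: the velocity is also made to vanish outside `0 < y < m`. -/
lemma exists_correction_y {n m : ℤ} (hn : 0 < n) (hm : 0 < m) {κ Q B : ℝ} (hκ : (n : ℝ) ≤ κ * m)
    (hB : 0 ≤ B) (hQB : Q ≤ B) (q u v : ℤ → ℤ → ℝ)
    (hq : ∀ i j, ¬(0 ≤ i ∧ i < n ∧ 0 ≤ j ∧ j < m) → q i j = 0)
    (hq0 : ∑ j ∈ Ico 0 m, ∑ i ∈ Ico 0 n, q i j = 0)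
    (hqQ : ∑ j ∈ Ico (-(5 * m)) (6 * m), ∑ i ∈ Ico 0 n, q i j ^ 2 ≤ Q)
    (hu : ∀ j, u 0 j = 0 ∧ u n j = 0)
    (hv : ∀ j, -(5 * m) ≤ j → j ≤ 6 * m → v (-1) j = 0 ∧ v n j = 0)
    (hv0 : ∀ i, 0 ≤ i → i < n → v i (-(5 * m)) = 0)
    (hdiv : ∀ i ∈ Ico 0 n, ∀ j ∈ Ico (-(5 * m)) (6 * m),
        u (i + 1) j - u i j + (v i (j + 1) - v i j) = q i j)
    (hux : ∑ j ∈ Ico (-(5 * m)) (6 * m), ∑ i ∈ Ico 0 n, (u (i + 1) j - u i j) ^ 2 ≤ B)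
    (huy : ∑ j ∈ Ioo (-(5 * m)) (6 * m), ∑ i ∈ Icc 0 n, (u i j - u i (j - 1)) ^ 2 ≤ B)
    (hvx : ∑ j ∈ Ioo (-(5 * m)) (6 * m), ∑ i ∈ Icc 0 n, (v i j - v (i - 1) j) ^ 2 ≤ B) :
    ∃ u' v' : ℤ → ℤ → ℝ,
      (∀ j, 0 ≤ j → j < m → u' 0 j = 0 ∧ u' n j = 0) ∧
      (∀ i, v' i 0 = 0 ∧ v' i m = 0) ∧
      (∀ i, 0 ≤ i → i ≤ n → u' i (-1) = 0 ∧ u' i m = 0) ∧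
      (∀ j, 0 ≤ j → j ≤ m → v' (-1) j = 0 ∧ v' n j = 0) ∧
      (∀ i ∈ Ico 0 n, ∀ j ∈ Ico 0 m,
        u' (i + 1) j - u' i j + (v' i (j + 1) - v' i j) = q i j) ∧
      ∑ i ∈ Ico 0 n, ∑ j ∈ Ico 0 m, (v' i (j + 1) - v' i j) ^ 2
        ≤ 2 * 10 ^ 6 * (1 + κ ^ 2) ^ 2 * B ∧
      ∑ i ∈ Icc 0 n, ∑ j ∈ Icc 0 m, (v' i j - v' (i - 1) j) ^ 2
        ≤ 2 * 10 ^ 6 * (1 + κ ^ 2) ^ 2 * B ∧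
      ∑ i ∈ Icc 0 n, ∑ j ∈ Icc 0 m, (u' i j - u' i (j - 1)) ^ 2
        ≤ 2 * 10 ^ 6 * (1 + κ ^ 2) ^ 2 * B := by
  have hn' : (0 : ℝ) < n := by exact_mod_cast hn
  have hn1 : (1 : ℝ) ≤ n := by exact_mod_cast hn
  have hm' : (0 : ℝ) < m := by exact_mod_cast hm
  have hκ2 : (n : ℝ) ^ 2 ≤ κ ^ 2 * m ^ 2 := by
    rw [← mul_pow]; exact pow_le_pow_left₀ hn'.le hκ 2
  -- The stream function is now normalized to vanish on the left wall; its sign is opposite to that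
  -- in the first correction.
  let φ : ℤ → ℤ → ℝ := fun i j => ∑ k ∈ Ico 0 i, v k j
  have hφ0 : ∀ j, φ 0 j = 0 := fun j => by simp [φ]
  have hφx : ∀ i j, 0 ≤ i → φ (i + 1) j - φ i j = v i j := fun i j hi => by
    simp only [φ]; rw [sum_Ico_add_one hi]; ring
  have hφy' : ∀ i, 0 ≤ i → i ≤ n → ∀ j ∈ Ico (-(5 * m)) (6 * m),
      φ i (j + 1) - φ i j = ∑ k ∈ Ico 0 i, q k j - u i j := by
    intro i h1 h2 j hj
    have e := sum_Ico_diff h1 fun k => u k j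
    rw [(hu j).1, sub_zero] at e
    simp only [φ]
    rw [← e, ← Finset.sum_sub_distrib, ← Finset.sum_sub_distrib]
    refine Finset.sum_congr rfl fun k hk => ?_
    rw [Finset.mem_Ico] at hk
    have := hdiv k (Finset.mem_Ico.mpr ⟨hk.1, by omega⟩) j hj
    linarith
  have hφy : ∀ i, 0 ≤ i → i ≤ n → ∀ j, -(5 * m) ≤ j → j < 6 * m → (j < 0 ∨ m ≤ j) →
      φ i (j + 1) - φ i j = -u i j := by
    intro i h1 h2 j h3 h4 h5
    rw [hφy' i h1 h2 j (Finset.mem_Ico.mpr ⟨h3, h4⟩),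
      Finset.sum_eq_zero fun k _ => hq k j (by omega), zero_sub]
  -- On the right wall the vertical increments of `φ` are the row sums of `q`. So `φ` is zero below
  -- the rectangle, and above it equals the total of `q`, which is zero.
  have hφn : ∀ j, -(5 * m) ≤ j → j ≤ 6 * m → (j ≤ 0 ∨ m ≤ j) → φ n j = 0 := by
    intro j h1 h2 h3
    have h0 : φ n (-(5 * m)) = 0 := Finset.sum_eq_zero fun k hk => by
      rw [Finset.mem_Ico] at hk; exact hv0 k hk.1 hk.2
    have e := sum_Ico_diff h1 fun j => φ n j
    rw [h0, sub_zero] at e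
    rw [← e]
    have e2 : ∑ k ∈ Ico (-(5 * m)) j, (φ n (k + 1) - φ n k)
        = ∑ k ∈ Ico (-(5 * m)) j, ∑ i ∈ Ico 0 n, q i k :=
      Finset.sum_congr rfl fun k hk => by
        rw [Finset.mem_Ico] at hk
        rw [hφy' n hn.le le_rfl k (Finset.mem_Ico.mpr ⟨hk.1, by omega⟩), (hu k).2, sub_zero]
    rw [e2]
    rcases h3 with h3 | h3
    · refine Finset.sum_eq_zero fun k hk => Finset.sum_eq_zero fun i _ => hq i k ?_
      rw [Finset.mem_Ico] at hk; omega
    · rw [← hq0]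
      refine (Finset.sum_subset (fun k hk => ?_) fun k _ hk => ?_).symm
      · rw [Finset.mem_Ico] at hk ⊢; omega
      · refine Finset.sum_eq_zero fun i _ => hq i k ?_
        rw [Finset.mem_Ico] at hk; omega
  let G : ℤ → ℤ → ℝ := fun i j => ext m (fun k => φ i k) j
  have hGo : ∀ i j, (j ≤ 0 ∨ m ≤ j) → G i j = φ i j := fun i j hj => ext_of_outer hm _ hj
  have hGx : ∀ i j, 0 ≤ i → G (i + 1) j - G i j = ext m (fun k => v i k) j := by
    intro i j hi
    simp only [G]
    rw [← ext_sub]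
    congr 1
    ext k
    exact hφx i k hi
  have hext0 : ∀ f : ℤ → ℝ, (∀ j, -(5 * m) ≤ j → j ≤ 6 * m → (j ≤ 0 ∨ m ≤ j) → f j = 0) →
      ∀ j, 0 ≤ j → j ≤ m → ext m f j = 0 := by
    intro f hf j h1 h2
    rw [ext_congr (g := fun _ => 0) h1 h2 fun k h3 h4 h5 => hf k (by omega) (by omega) h5,
      ext_zero]
  -- The first correction leaves no direct bound on `v_y`; it is recovered from the divergence
  -- equation.
  have hvy : ∑ j ∈ Ico (-(5 * m)) (6 * m), ∑ i ∈ Ico 0 n, (v i (j + 1) - v i j) ^ 2 ≤ 4 * B := by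
    have : ∑ j ∈ Ico (-(5 * m)) (6 * m), ∑ i ∈ Ico 0 n, (v i (j + 1) - v i j) ^ 2
        ≤ ∑ j ∈ Ico (-(5 * m)) (6 * m), ∑ i ∈ Ico 0 n,
          (2 * q i j ^ 2 + 2 * (u (i + 1) j - u i j) ^ 2) := by
      refine Finset.sum_le_sum fun j hj => Finset.sum_le_sum fun i hi => ?_
      have := hdiv i hi j hj
      rw [show v i (j + 1) - v i j = q i j - (u (i + 1) j - u i j) by linarith]
      nlinarith [sq_nonneg (q i j + (u (i + 1) j - u i j))]
    simp only [Finset.sum_add_distrib, ← Finset.mul_sum] at this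
    linarith
  -- Since `v` vanishes at column `-1`, the Poincaré inequality runs over `n + 1` steps, and `(n +
  -- 1)² ≤ 4n²`.
  have hv2 : ∑ j ∈ Ioo (-(5 * m)) (6 * m), ∑ i ∈ Ico 0 n, v i j ^ 2 ≤ 4 * n ^ 2 * B := by
    have h1 : ∑ j ∈ Ioo (-(5 * m)) (6 * m), ∑ i ∈ Ico 0 (n + 1), v (i - 1) j ^ 2
        ≤ ((n + 1 : ℤ) - (0 : ℤ) : ℝ) ^ 2 * B := by
      refine sum_lines_sq_le_of_eq_zero (fun j i => v (i - 1) j) (fun j hj => ?_) ?_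
      · rw [Finset.mem_Ioo] at hj
        exact (hv j hj.1.le hj.2.le).1
      · simp only [add_sub_cancel_right]
        exact (Finset.sum_le_sum fun j _ => Finset.sum_le_sum_of_subset_of_nonneg
          (fun i hi => by rw [Finset.mem_Ico] at hi; rw [Finset.mem_Icc]; omega)
          fun _ _ _ => sq_nonneg _).trans hvx
    have h2 : ∑ j ∈ Ioo (-(5 * m)) (6 * m), ∑ i ∈ Ico 0 n, v i j ^ 2
        ≤ ∑ j ∈ Ioo (-(5 * m)) (6 * m), ∑ i ∈ Ico 0 (n + 1), v (i - 1) j ^ 2 := by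
      refine Finset.sum_le_sum fun j _ => ?_
      have := sum_comp_le (s := Ico 0 n) (t := Ico 0 (n + 1)) (g := fun i => v (i - 1) j ^ 2)
        (fun _ _ => sq_nonneg _) (fun i => i + 1) (fun a b h => by simpa using h)
        (fun i hi h => absurd h (by simp only [Finset.mem_Ico] at hi ⊢; omega))
      simpa only [add_sub_cancel_right] using this
    refine h2.trans (h1.trans ?_)
    push_cast
    refine mul_le_mul_of_nonneg_right ?_ hB
    nlinarith
  have hu2 : ∑ j ∈ Ico (-(5 * m)) (6 * m), ∑ i ∈ Ico 0 n, u i j ^ 2 ≤ n ^ 2 * B := by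
    refine (sum_lines_sq_le_of_eq_zero (fun j i => u i j) (fun j _ => (hu j).1) hux).trans
      (le_of_eq ?_)
    push_cast; ring
  have hu2' : ∑ j ∈ Ico (-(5 * m)) (6 * m), ∑ i ∈ Icc 0 n, u i j ^ 2 ≤ n ^ 2 * B := by
    refine le_trans (le_of_eq ?_) hu2
    refine Finset.sum_congr rfl fun j _ => ?_
    rw [show Icc 0 n = Ico 0 (n + 1) by ext k; simp only [Finset.mem_Icc, Finset.mem_Ico]; omega,
      sum_Ico_add_one hn.le, (hu j).2]
    simp
  have hφ2 : ∑ j ∈ Ioo (-(5 * m)) (6 * m), ∑ i ∈ Icc 0 n, φ i j ^ 2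
      ≤ (n + 1) ^ 2 * (4 * n ^ 2 * B) := by
    have h1 : ∑ j ∈ Ioo (-(5 * m)) (6 * m), ∑ i ∈ Ico 0 (n + 1), φ i j ^ 2
        ≤ ((n + 1 : ℤ) - (0 : ℤ) : ℝ) ^ 2 * (4 * n ^ 2 * B) := by
      refine sum_lines_sq_le_of_eq_zero (fun j i => φ i j) (fun j _ => hφ0 j) ?_
      refine le_trans (le_of_eq ?_) hv2
      refine Finset.sum_congr rfl fun j hj => ?_
      rw [Finset.mem_Ioo] at hj
      rw [sum_Ico_add_one hn.le, hφx n j hn.le, (hv j hj.1.le hj.2.le).2]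
      simp only [ne_eq, OfNat.ofNat_ne_zero, not_false_eq_true, zero_pow, add_zero]
      refine Finset.sum_congr rfl fun i hi => ?_
      rw [Finset.mem_Ico] at hi
      rw [hφx i j hi.1]
    have e : Icc 0 n = Ico 0 (n + 1) := by
      ext k; simp only [Finset.mem_Icc, Finset.mem_Ico]; omega
    rw [e]
    refine h1.trans (le_of_eq ?_)
    push_cast; ring
  have hκB : 0 ≤ κ ^ 2 * B := by positivity
  have hκB' : 0 ≤ κ ^ 4 * B := by positivity
  have hκ4 : (n : ℝ) ^ 4 ≤ κ ^ 4 * m ^ 4 := by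
    rw [← mul_pow]; exact pow_le_pow_left₀ hn'.le hκ 4
  refine ⟨fun i j => u i j + (G i (j + 1) - G i j), fun i j => v i j - ext m (fun k => v i k) j,
    ?_, ?_, ?_, ?_, ?_, ?_, ?_, ?_⟩
  · intro j h1 h2
    -- The outer values of `φ` on the left and right walls are zero, hence so are their extensions:
    -- the second correction preserves the normal condition gained before.
    have a : ∀ j, 0 ≤ j → j ≤ m → G 0 j = 0 := hext0 _ fun j _ _ _ => hφ0 j
    have b : ∀ j, 0 ≤ j → j ≤ m → G n j = 0 := hext0 _ hφn
    simp only
    rw [a j h1 h2.le, a (j + 1) (by omega) (by omega), b j h1 h2.le, b (j + 1) (by omega) (by omega),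
      (hu j).1, (hu j).2]
    simp
  · intro i
    simp only
    rw [ext_of_outer hm _ (Or.inl le_rfl), ext_of_outer hm _ (Or.inr le_rfl)]
    simp
  · intro i h1 h2
    simp only
    have a := hφy i h1 h2 (-1) (by omega) (by omega) (by omega)
    have b := hφy i h1 h2 m (by omega) (by omega) (by omega)
    rw [hGo _ _ (by omega), hGo _ _ (by omega), hGo _ _ (by omega), hGo _ _ (by omega), a, b]
    simp
  · intro j h1 h2
    simp only
    rw [hext0 _ (fun k a b _ => (hv k a b).1) j h1 h2, hext0 _ (fun k a b _ => (hv k a b).2) j h1 h2,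
      (hv j (by omega) (by omega)).1, (hv j (by omega) (by omega)).2]
    simp
  · intro i hi j hj
    have hi' := Finset.mem_Ico.mp hi
    rw [Finset.mem_Ico] at hj
    have a := hGx i j hi'.1
    have b := hGx i (j + 1) hi'.1
    have c := hdiv i hi j (Finset.mem_Ico.mpr ⟨by omega, by omega⟩)
    simp only
    linarith
  · rw [Finset.sum_comm] at hvy
    refine (sum_lines_sub_ext_diff_sq_le (B := 4 * κ ^ 2 * B) hm (fun i j => v i j) hvy ?_).trans ?_
    · rw [Finset.sum_comm]
      refine hv2.trans ?_
      nlinarith [mul_le_mul_of_nonneg_right hκ2 hB]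
    · nlinarith
  · have e : ∀ i j, (v i j - ext m (fun k => v i k) j)
        - (v (i - 1) j - ext m (fun k => v (i - 1) k) j)
        = (v i j - v (i - 1) j) - ext m (fun k => v i k - v (i - 1) k) j := by
      intro i j; rw [ext_sub m (fun k => v i k) fun k => v (i - 1) k]; ring
    simp only [e]
    rw [Finset.sum_comm] at hvx
    refine (sum_lines_sub_ext_sq_le hm (fun i j => v i j - v (i - 1) j) hvx).trans ?_
    nlinarith
  · simp only [sub_add_cancel]
    rw [Finset.sum_comm] at huy
    refine (sum_lines_add_ext_diff_sq_le (B := κ ^ 2 * B) (C := 16 * κ ^ 4 * B) hm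
      (fun i j => φ i j) (fun i j => u i j) ?_ huy ?_ ?_).trans ?_
    · intro i hi j h1 h2 h3
      rw [Finset.mem_Icc] at hi
      exact hφy i hi.1 hi.2 j h1 h2 h3
    · rw [Finset.sum_comm]
      refine hu2'.trans ?_
      nlinarith [mul_le_mul_of_nonneg_right hκ2 hB]
    · rw [Finset.sum_comm]
      refine hφ2.trans ?_
      have h4 : ((n : ℝ) + 1) ^ 2 ≤ 4 * n ^ 2 := by nlinarith
      have h5 : 0 ≤ 4 * (n : ℝ) ^ 2 * B := by positivity
      nlinarith [mul_le_mul_of_nonneg_right hκ4 hB, mul_le_mul_of_nonneg_right h4 h5]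
    · nlinarith


section

/-! ### Velocities as functions on the integer lattice -/

lemma sum_fin_eq_sum_Ico (N : ℕ) (a : ℤ) (g : ℤ → ℝ) :
    ∑ I : Fin N, g (a + I) = ∑ i ∈ Ico a (a + N), g i := by
  induction N with
  | zero => simp
  | succ N ih =>
    rw [Fin.sum_univ_castSucc, Nat.cast_succ, ← add_assoc, sum_Ico_add_one (by omega), ← ih]
    simp

lemma sum_fin_eq_sum_Ioo {N : ℕ} (hN : 0 < N) (a : ℤ) (g : ℤ → ℝ) :
    ∑ k : Fin (N - 1), g (a + 1 + k) = ∑ i ∈ Ioo a (a + N), g i := by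
  rw [sum_fin_eq_sum_Ico]
  refine Finset.sum_congr ?_ fun _ _ => rfl
  ext i
  rw [Finset.mem_Ico, Finset.mem_Ioo]
  omega

lemma sum_faceToCell_lift {N : ℕ} {a : ℤ} {f : ℤ → ℝ} {g : Fin (N - 1) → ℝ} (h0 : f a = 0)
    (h1 : f (a + N) = 0) (hg : ∀ k : Fin (N - 1), f (a + 1 + k) = g k) (I : Fin N) :
    ∑ k, faceToCell N 1 I k * g k = f (a + I + 1) - f (a + I) := by
  rw [sum_faceToCell, inv_one, one_mul]
  congr 1
  · split_ifs with hi
    · rw [← hg]; congr 1; simp only; ring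
    · rw [← h1]; congr 1; omega
  · split_ifs with hi
    · rw [← hg]; congr 1; simp only; omega
    · rw [← h0]; congr 1; omega

/-- With zero values half a cell beyond each wall, the wall weights are the two differences across
the walls, which complete the sum of interior squared differences to the closed interval. -/
lemma sum_wall_lift {N : ℕ} (hN : 0 < N) {b : ℤ} {f : ℤ → ℝ} (h0 : f (b - 1) = 0)
    (h1 : f (b + N) = 0) :
    ∑ J : Fin N, ((if J.val = 0 then 1 else 0) + (if J.val + 1 = N then (1 : ℝ) else 0))
        * f (b + J) ^ 2 + ∑ j ∈ Ioo b (b + N), (f j - f (j - 1)) ^ 2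
      = ∑ j ∈ Icc b (b + N), (f j - f (j - 1)) ^ 2 := by
  have e1 : ∑ J : Fin N, ((if J.val = 0 then 1 else 0) + (if J.val + 1 = N then (1 : ℝ) else 0))
      * f (b + J) ^ 2 = f b ^ 2 + f (b + N - 1) ^ 2 := by
    simp only [add_mul, Finset.sum_add_distrib]
    congr 1
    · rw [Fintype.sum_eq_single (⟨0, hN⟩ : Fin N)]
      · simp
      · intro J hJ
        rw [if_neg (by simpa [Fin.ext_iff] using hJ), zero_mul]
    · rw [Fintype.sum_eq_single (⟨N - 1, by omega⟩ : Fin N)]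
      · rw [if_pos (by simp only; omega), one_mul]
        congr 2
        simp only
        omega
      · intro J hJ
        rw [if_neg (by simp only [ne_eq, Fin.ext_iff] at hJ; omega), zero_mul]
  have e2 : Icc b (b + N) = insert b (insert (b + N : ℤ) (Ioo b (b + N))) := by
    ext i
    simp only [Finset.mem_Icc, Finset.mem_insert, Finset.mem_Ioo]
    omega
  rw [e1, e2, Finset.sum_insert, Finset.sum_insert (by simp), h0, h1]
  · ring
  · simp only [Finset.mem_insert, Finset.mem_Ioo]
    omega

/-- The lattice functions `u`, `v` carry the values of `w`, the lower left corner of the rectangle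
being `(a, b)`. -/
structure IsLift (N M : ℕ) (a b : ℤ) (w : Face N M → ℝ) (u v : ℤ → ℤ → ℝ) : Prop where
  left : ∀ J : Fin M, u a (b + J) = 0
  right : ∀ J : Fin M, u (a + N) (b + J) = 0
  bottom : ∀ I : Fin N, v (a + I) b = 0
  top : ∀ I : Fin N, v (a + I) (b + M) = 0
  inl : ∀ k J, u (a + 1 + (k : Fin (N - 1))) (b + (J : Fin M)) = w (Sum.inl (k, J))
  inr : ∀ I k, v (a + (I : Fin N)) (b + 1 + (k : Fin (M - 1))) = w (Sum.inr (I, k))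

variable {N M : ℕ} {a b : ℤ} {w : Face N M → ℝ} {u v : ℤ → ℤ → ℝ}

/-- Extension by zero; with the coordinates exchanged it serves the second component too. -/
lemma exists_lift_aux (N M : ℕ) (a b : ℤ) (w : Fin (N - 1) × Fin M → ℝ) : ∃ u : ℤ → ℤ → ℝ,
    (∀ j, u a j = 0) ∧ (∀ j, u (a + N) j = 0) ∧
      ∀ (k : Fin (N - 1)) (J : Fin M), u (a + 1 + k) (b + J) = w (k, J) := by
  classical
  refine ⟨fun i j => if h : a < i ∧ i < a + N ∧ b ≤ j ∧ j < b + M then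
    w (⟨(i - a - 1).toNat, by omega⟩, ⟨(j - b).toNat, by omega⟩) else 0, ?_, ?_, ?_⟩
  · intro j; exact dif_neg (by omega)
  · intro j; exact dif_neg (by omega)
  · intro k J
    beta_reduce
    rw [dif_pos (by omega)]
    congr 3 <;> omega

lemma exists_isLift (N M : ℕ) (a b : ℤ) (w : Face N M → ℝ) :
    ∃ u v : ℤ → ℤ → ℝ, IsLift N M a b w u v ∧ (∀ j, u a j = 0) ∧ ∀ i, v i b = 0 := by
  obtain ⟨u, u1, u2, u3⟩ := exists_lift_aux N M a b (w ∘ Sum.inl)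
  obtain ⟨v, v1, v2, v3⟩ := exists_lift_aux M N b a (w ∘ Sum.inr ∘ Prod.swap)
  exact ⟨u, fun i j => v j i, ⟨fun _ => u1 _, fun _ => u2 _, fun _ => v1 _, fun _ => v2 _, u3,
    fun I k => v3 k I⟩, u1, v1⟩

lemma IsLift.faceToCell_left (hw : IsLift N M a b w u v) (I : Fin N) (J : Fin M) :
    ((faceToCell N 1 ⊗ₖ (1 : Matrix (Fin M) (Fin M) ℝ)) *ᵥ (w ∘ Sum.inl)) (I, J)
      = u (a + I + 1) (b + J) - u (a + I) (b + J) := by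
  rw [kronecker_one_mulVec]
  exact sum_faceToCell_lift (f := fun i => u i (b + J)) (hw.left J) (hw.right J)
    (fun k => hw.inl k J) I

lemma IsLift.faceToCell_right (hw : IsLift N M a b w u v) (I : Fin N) (J : Fin M) :
    (((1 : Matrix (Fin N) (Fin N) ℝ) ⊗ₖ faceToCell M 1) *ᵥ (w ∘ Sum.inr)) (I, J)
      = v (a + I) (b + J + 1) - v (a + I) (b + J) := by
  rw [one_kronecker_mulVec]
  exact sum_faceToCell_lift (f := fun j => v (a + I) j) (hw.bottom I) (hw.top I)
    (fun k => hw.inr I k) J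

lemma IsLift.cellToFace_left (hw : IsLift N M a b w u v) (k : Fin (N - 1)) (l : Fin (M - 1)) :
    (((1 : Matrix (Fin (N - 1)) (Fin (N - 1)) ℝ) ⊗ₖ cellToFace M 1) *ᵥ (w ∘ Sum.inl)) (k, l)
      = u (a + 1 + k) (b + 1 + l) - u (a + 1 + k) (b + 1 + l - 1) := by
  rw [one_kronecker_mulVec, sum_cellToFace, Function.comp_apply, Function.comp_apply, ← hw.inl,
    ← hw.inl, inv_one, one_mul]
  congr 2 <;> push_cast <;> ring

lemma IsLift.cellToFace_right (hw : IsLift N M a b w u v) (k : Fin (N - 1)) (l : Fin (M - 1)) :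
    ((cellToFace N 1 ⊗ₖ (1 : Matrix (Fin (M - 1)) (Fin (M - 1)) ℝ)) *ᵥ (w ∘ Sum.inr)) (k, l)
      = v (a + 1 + k) (b + 1 + l) - v (a + 1 + k - 1) (b + 1 + l) := by
  rw [kronecker_one_mulVec, sum_cellToFace, Function.comp_apply, Function.comp_apply, ← hw.inr,
    ← hw.inr, inv_one, one_mul]
  congr 2 <;> push_cast <;> ring

lemma IsLift.div_apply (hw : IsLift N M a b w u v) (I : Fin N) (J : Fin M) :
    (div N M 1 *ᵥ w) (I, J) = u (a + I + 1) (b + J) - u (a + I) (b + J)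
      + (v (a + I) (b + J + 1) - v (a + I) (b + J)) := by
  rw [div, fromCols_mulVec, Pi.add_apply, hw.faceToCell_left, hw.faceToCell_right]

lemma IsLift.energy_eq (hw : IsLift N M a b w u v) (hN : 0 < N) (hM : 0 < M) :
    -(w ⬝ᵥ lap N M 1 *ᵥ w)
      = (∑ i ∈ Ico a (a + N), ∑ j ∈ Ico b (b + M), (u (i + 1) j - u i j) ^ 2
        + ∑ i ∈ Ioo a (a + N), ∑ j ∈ Ioo b (b + M), (u i j - u i (j - 1)) ^ 2)
      + (∑ i ∈ Ioo a (a + N), ∑ j ∈ Ioo b (b + M), (v i j - v (i - 1) j) ^ 2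
        + ∑ i ∈ Ico a (a + N), ∑ j ∈ Ico b (b + M), (v i (j + 1) - v i j) ^ 2)
      + 2 * (w ⬝ᵥ wall N M *ᵥ w) := by
  rw [energy_eq_diff, one_pow, inv_one, mul_one]
  simp only [Fintype.sum_prod_type, hw.faceToCell_left, hw.faceToCell_right, hw.cellToFace_left,
    hw.cellToFace_right]
  rw [← sum_fin_eq_sum_Ico N a fun i => ∑ j ∈ Ico b (b + M), (u (i + 1) j - u i j) ^ 2,
    ← sum_fin_eq_sum_Ico N a fun i => ∑ j ∈ Ico b (b + M), (v i (j + 1) - v i j) ^ 2,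
    ← sum_fin_eq_sum_Ioo hN a fun i => ∑ j ∈ Ioo b (b + M), (u i j - u i (j - 1)) ^ 2,
    ← sum_fin_eq_sum_Ioo hN a fun i => ∑ j ∈ Ioo b (b + M), (v i j - v (i - 1) j) ^ 2]
  simp only [← sum_fin_eq_sum_Ico, ← sum_fin_eq_sum_Ioo hM]

lemma IsLift.wall_eq (hw : IsLift N M a b w u v) (hN : 0 < N) (hM : 0 < M)
    (hu : ∀ k : Fin (N - 1), u (a + 1 + k) (b - 1) = 0 ∧ u (a + 1 + k) (b + M) = 0)
    (hv : ∀ k : Fin (M - 1), v (a - 1) (b + 1 + k) = 0 ∧ v (a + N) (b + 1 + k) = 0) :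
    w ⬝ᵥ wall N M *ᵥ w + ∑ i ∈ Ioo a (a + N), ∑ j ∈ Ioo b (b + M), (u i j - u i (j - 1)) ^ 2
        + ∑ i ∈ Ioo a (a + N), ∑ j ∈ Ioo b (b + M), (v i j - v (i - 1) j) ^ 2
      = ∑ i ∈ Ioo a (a + N), ∑ j ∈ Icc b (b + M), (u i j - u i (j - 1)) ^ 2
        + ∑ j ∈ Ioo b (b + M), ∑ i ∈ Icc a (a + N), (v i j - v (i - 1) j) ^ 2 := by
  have e : w ⬝ᵥ wall N M *ᵥ w
      = ∑ k : Fin (N - 1), ∑ J : Fin M, ((if J.val = 0 then 1 else 0)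
          + (if J.val + 1 = M then (1 : ℝ) else 0)) * u (a + 1 + k) (b + J) ^ 2
        + ∑ k : Fin (M - 1), ∑ I : Fin N, ((if I.val = 0 then 1 else 0)
          + (if I.val + 1 = N then (1 : ℝ) else 0)) * v (a + I) (b + 1 + k) ^ 2 := by
    rw [MAC.wall_eq, dotProduct, Fintype.sum_sum_type, Fintype.sum_prod_type, Fintype.sum_prod_type,
      Finset.sum_comm (s := (Finset.univ : Finset (Fin N)))]
    congr 1
    · refine Finset.sum_congr rfl fun k _ => Finset.sum_congr rfl fun J _ => ?_
      rw [mulVec_diagonal, hw.inl, Sum.elim_inl]; ring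
    · refine Finset.sum_congr rfl fun k _ => Finset.sum_congr rfl fun I _ => ?_
      rw [mulVec_diagonal, hw.inr, Sum.elim_inr]; ring
  rw [e, Finset.sum_comm (s := Ioo a (a + N)) (t := Ioo b (b + M)) (f := fun i j =>
    (v i j - v (i - 1) j) ^ 2)]
  rw [← sum_fin_eq_sum_Ioo hN a fun i => ∑ j ∈ Ioo b (b + M), (u i j - u i (j - 1)) ^ 2,
    ← sum_fin_eq_sum_Ioo hN a fun i => ∑ j ∈ Icc b (b + M), (u i j - u i (j - 1)) ^ 2,
    ← sum_fin_eq_sum_Ioo hM b fun j => ∑ i ∈ Ioo a (a + N), (v i j - v (i - 1) j) ^ 2,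
    ← sum_fin_eq_sum_Ioo hM b fun j => ∑ i ∈ Icc a (a + N), (v i j - v (i - 1) j) ^ 2]
  rw [← Finset.sum_congr rfl fun (k : Fin (N - 1)) _ => sum_wall_lift hM
      (f := fun j => u (a + 1 + k) j) (hu k).1 (hu k).2,
    ← Finset.sum_congr rfl fun (k : Fin (M - 1)) _ => sum_wall_lift hN
      (f := fun i => v i (b + 1 + k)) (hv k).1 (hv k).2, Finset.sum_add_distrib,
    Finset.sum_add_distrib]
  ring

/-- A velocity with prescribed divergence, normal velocity zero on the walls and free slip. -/
lemma exists_slip_velocity (hN : 0 < N) (hM : 0 < M) (a b : ℤ) (q : ℤ → ℤ → ℝ)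
    (hq : ∑ i ∈ Ico a (a + N), ∑ j ∈ Ico b (b + M), q i j = 0) :
    ∃ u v : ℤ → ℤ → ℝ, (∀ j, u a j = 0) ∧ (∀ i, v i b = 0) ∧
      (∀ i ∈ Ico a (a + N), ∀ j ∈ Ico b (b + M),
        u (i + 1) j - u i j + (v i (j + 1) - v i j) = q i j) ∧
      (∑ i ∈ Ico a (a + N), ∑ j ∈ Ico b (b + M), (u (i + 1) j - u i j) ^ 2
        + ∑ i ∈ Ioo a (a + N), ∑ j ∈ Ioo b (b + M), (u i j - u i (j - 1)) ^ 2)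
      + (∑ i ∈ Ioo a (a + N), ∑ j ∈ Ioo b (b + M), (v i j - v (i - 1) j) ^ 2
        + ∑ i ∈ Ico a (a + N), ∑ j ∈ Ico b (b + M), (v i (j + 1) - v i j) ^ 2)
      = ∑ i ∈ Ico a (a + N), ∑ j ∈ Ico b (b + M), q i j ^ 2 := by
  -- The velocity is the gradient of a Neumann potential, hence curl-free.
  obtain ⟨φ, hφ⟩ := exists_potential hN hM one_ne_zero (fun c => q (a + c.1) (b + c.2)) (by
    rw [Fintype.sum_prod_type, ← hq,
      ← sum_fin_eq_sum_Ico N a fun i => ∑ j ∈ Ico b (b + M), q i j]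
    simp only [← sum_fin_eq_sum_Ico])
  obtain ⟨u, v, hw, hu, hv⟩ := exists_isLift N M a b (grad N M 1 *ᵥ φ)
  refine ⟨u, v, hu, hv, ?_, ?_⟩
  · intro i hi j hj
    rw [Finset.mem_Ico] at hi hj
    have h1 := hw.div_apply ⟨(i - a).toNat, by omega⟩ ⟨(j - b).toNat, by omega⟩
    rw [hφ] at h1
    have e1 : a + ((i - a).toNat : ℤ) = i := by omega
    have e2 : b + ((j - b).toNat : ℤ) = j := by omega
    simp only [e1, e2] at h1
    exact h1.symm
  · have h1 := hw.energy_eq hN hM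
    rw [MAC.energy_eq, hφ, mulVec_mulVec, curl_mul_grad, zero_mulVec, zero_dotProduct, one_pow,
      inv_one, mul_one, add_zero] at h1
    -- Both expressions for the energy carry the same wall term. Cancelling it leaves the free-slip
    -- energy, equal to the squared norm of the divergence.
    rw [← add_right_cancel h1, dotProduct, Fintype.sum_prod_type,
      ← sum_fin_eq_sum_Ico N a fun i => ∑ j ∈ Ico b (b + M), q i j ^ 2]
    simp only [← sum_fin_eq_sum_Ico, pow_two]

end


/-! ### A uniformly bounded right inverse of the divergence -/

lemma exists_isLift_of (N M : ℕ) (u v : ℤ → ℤ → ℝ)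
    (hu : ∀ j : ℤ, 0 ≤ j → j < M → u 0 j = 0 ∧ u N j = 0)
    (hv : ∀ i : ℤ, v i 0 = 0 ∧ v i M = 0) : ∃ w, IsLift N M 0 0 w u v := by
  refine ⟨Sum.elim (fun c => u (0 + 1 + (c.1 : ℕ)) (0 + (c.2 : ℕ)))
    (fun c => v (0 + (c.1 : ℕ)) (0 + 1 + (c.2 : ℕ))), ?_, ?_, ?_, ?_, ?_, ?_⟩
  · intro J; exact (hu _ (by omega) (by omega)).1
  · intro J; rw [zero_add]; exact (hu _ (by omega) (by omega)).2
  · intro I; exact (hv _).1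
  · intro I; rw [zero_add (M : ℤ)]; exact (hv _).2
  · intro k J; rfl
  · intro I k; rfl

lemma sum_Ico_Ico_eq_of_support {n m : ℤ} (hn : 0 < n) (hm : 0 < m) (g : ℤ → ℤ → ℝ)
    (hg : ∀ i j, ¬(0 ≤ i ∧ i < n ∧ 0 ≤ j ∧ j < m) → g i j = 0) :
    ∑ i ∈ Ico (-(5 * n)) (6 * n), ∑ j ∈ Ico (-(5 * m)) (6 * m), g i j
      = ∑ i ∈ Ico 0 n, ∑ j ∈ Ico 0 m, g i j := by
  symm
  rw [← Finset.sum_subset (s₁ := Ico 0 n) (s₂ := Ico (-(5 * n)) (6 * n))]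
  · refine Finset.sum_congr rfl fun i _ => Finset.sum_subset ?_ ?_
    · intro j hj; rw [Finset.mem_Ico] at hj ⊢; omega
    · intro j _ hj
      exact hg i j (by rw [Finset.mem_Ico] at hj; omega)
  · intro i hi; rw [Finset.mem_Ico] at hi ⊢; omega
  · intro i _ hi
    exact Finset.sum_eq_zero fun j _ => hg i j (by rw [Finset.mem_Ico] at hi; omega)

/-- Free-slip solution on the enlarged rectangle, followed by the two corrections. The final energy
is at most `2Q + 7KB ≤ 9KB`, where `B` bounds the first correction and `K` is the factor of the
second; this explains the shape of `C`. -/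
theorem exists_right_inverse (κ : ℝ) : ∃ C : ℝ, 0 < C ∧ ∀ n m : ℕ, 0 < n → 0 < m →
    (n : ℝ) ≤ κ * m → (m : ℝ) ≤ κ * n → ∀ q : Cell n m → ℝ, ∑ c, q c = 0 →
      ∃ w, div n m 1 *ᵥ w = q ∧ -(w ⬝ᵥ lap n m 1 *ᵥ w) ≤ C * (q ⬝ᵥ q) := by
  refine ⟨9 * (2 * 10 ^ 6 * (1 + κ ^ 2) ^ 2) * (2 * 10 ^ 9 * (1 + κ ^ 2)), by positivity, ?_⟩
  intro n m hn hm hnm hmn q hq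
  have hnz : (0 : ℤ) < n := by exact_mod_cast hn
  have hmz : (0 : ℤ) < m := by exact_mod_cast hm
  obtain ⟨p, hp0, hp⟩ : ∃ p : ℤ → ℤ → ℝ,
      (∀ i j, ¬(0 ≤ i ∧ i < (n : ℤ) ∧ 0 ≤ j ∧ j < (m : ℤ)) → p i j = 0) ∧
      ∀ (I : Fin n) (J : Fin m), p (0 + I) (0 + J) = q (I, J) := by
    refine ⟨fun i j => if h : 0 ≤ i ∧ i < (n : ℤ) ∧ 0 ≤ j ∧ j < (m : ℤ) then
      q (⟨i.toNat, by omega⟩, ⟨j.toNat, by omega⟩) else 0, fun i j h => dif_neg h, fun I J => ?_⟩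
    beta_reduce
    rw [dif_pos (by omega)]
    congr 3 <;> omega
  set Q := q ⬝ᵥ q with hQ
  have hQ0 : 0 ≤ Q := Finset.sum_nonneg fun _ _ => mul_self_nonneg _
  have hps : ∑ i ∈ Ico (0 : ℤ) n, ∑ j ∈ Ico (0 : ℤ) m, p i j = 0 := by
    rw [← hq, Fintype.sum_prod_type]
    have := sum_fin_eq_sum_Ico n 0 fun i => ∑ j ∈ Ico (0 : ℤ) m, p i j
    rw [zero_add] at this
    rw [← this]
    refine Finset.sum_congr rfl fun I _ => ?_
    have := sum_fin_eq_sum_Ico m 0 fun j => p (0 + I) j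
    rw [zero_add (m : ℤ)] at this
    rw [← this]
    exact Finset.sum_congr rfl fun J _ => hp I J
  have hpQ : ∑ i ∈ Ico (0 : ℤ) n, ∑ j ∈ Ico (0 : ℤ) m, p i j ^ 2 = Q := by
    rw [hQ, dotProduct, Fintype.sum_prod_type]
    have := sum_fin_eq_sum_Ico n 0 fun i => ∑ j ∈ Ico (0 : ℤ) m, p i j ^ 2
    rw [zero_add] at this
    rw [← this]
    refine Finset.sum_congr rfl fun I _ => ?_
    have := sum_fin_eq_sum_Ico m 0 fun j => p (0 + I) j ^ 2
    rw [zero_add (m : ℤ)] at this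
    rw [← this]
    exact Finset.sum_congr rfl fun J _ => by rw [hp I J, pow_two]
  have hps' := (sum_Ico_Ico_eq_of_support hnz hmz p hp0).trans hps
  have hpQ' := (sum_Ico_Ico_eq_of_support hnz hmz (fun i j => p i j ^ 2)
    fun i j h => by simp [hp0 i j h]).trans hpQ
  have en : -(5 * (n : ℤ)) + ((11 * n : ℕ) : ℤ) = 6 * n := by push_cast; ring
  have em : -(5 * (m : ℤ)) + ((11 * m : ℕ) : ℤ) = 6 * m := by push_cast; ring
  have hslip := exists_slip_velocity (N := 11 * n) (M := 11 * m) (by omega) (by omega)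
    (-(5 * (n : ℤ))) (-(5 * (m : ℤ))) p (by rw [en, em]; exact hps')
  rw [en, em] at hslip
  obtain ⟨u₀, v₀, hu₀, hv₀, hdiv₀, hen₀⟩ := hslip
  rw [hpQ'] at hen₀
  have nn : ∀ (s t : Finset ℤ) (f : ℤ → ℤ → ℝ), 0 ≤ ∑ i ∈ s, ∑ j ∈ t, f i j ^ 2 :=
    fun s t f => Finset.sum_nonneg fun _ _ => Finset.sum_nonneg fun _ _ => sq_nonneg _
  have n1 := nn (Ico (-(5 * (n : ℤ))) (6 * n)) (Ico (-(5 * (m : ℤ))) (6 * m))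
    fun i j => u₀ (i + 1) j - u₀ i j
  have n2 := nn (Ioo (-(5 * (n : ℤ))) (6 * n)) (Ioo (-(5 * (m : ℤ))) (6 * m))
    fun i j => u₀ i j - u₀ i (j - 1)
  have n3 := nn (Ioo (-(5 * (n : ℤ))) (6 * n)) (Ioo (-(5 * (m : ℤ))) (6 * m))
    fun i j => v₀ i j - v₀ (i - 1) j
  have n4 := nn (Ico (-(5 * (n : ℤ))) (6 * n)) (Ico (-(5 * (m : ℤ))) (6 * m))
    fun i j => v₀ i (j + 1) - v₀ i j
  obtain ⟨u₁, v₁, hu₁, hv₁, hv₁', hdiv₁, hux₁, huy₁, hvx₁⟩ :=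
    exists_correction_x hnz hmz (κ := κ) (Q := Q) (by exact_mod_cast hmn) hQ0 p u₀ v₀ hp0 hu₀ hv₀
      hdiv₀ (by rw [Finset.sum_comm]; linarith) (by rw [Finset.sum_comm]; linarith)
      (by rw [Finset.sum_comm]; linarith) (by rw [Finset.sum_comm]; linarith)
  set B := 2 * 10 ^ 9 * (1 + κ ^ 2) * Q with hB
  have hQB : Q ≤ B := by
    rw [hB]; nlinarith [mul_nonneg (sq_nonneg κ) hQ0]
  obtain ⟨u, v, hu, hv, hu', hv', hdiv, hvy, hvx, huy⟩ :=
    exists_correction_y hnz hmz (κ := κ) (Q := Q) (B := B) (by exact_mod_cast hnm)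
      (hQ0.trans hQB) hQB p u₁ v₁ hp0 (by rw [Finset.sum_comm]; exact hps)
      (by
        rw [Finset.sum_comm, ← hpQ']
        exact sum_sum_sq_le (fun i hi => by rw [Finset.mem_Ico] at hi ⊢; omega) (Subset.refl _) p)
      hu₁ hv₁ hv₁' hdiv₁ hux₁ huy₁ hvx₁
  set K := 2 * 10 ^ 6 * (1 + κ ^ 2) ^ 2 with hK
  have hKB : B ≤ K * B := by
    have : 1 ≤ K := by rw [hK]; nlinarith [sq_nonneg κ, sq_nonneg (κ ^ 2)]
    nlinarith
  obtain ⟨w, hw⟩ := exists_isLift_of n m u v hu hv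
  refine ⟨w, ?_, ?_⟩
  · ext ⟨I, J⟩
    rw [hw.div_apply, ← hp]
    exact hdiv _ (by rw [Finset.mem_Ico]; omega) _ (by rw [Finset.mem_Ico]; omega)
  · have h1 := hw.energy_eq hn hm
    have h2 := hw.wall_eq hn hm (fun k => by simpa using hu' (1 + k) (by omega) (by omega))
      (fun k => by simpa using hv' (1 + k) (by omega) (by omega))
    simp only [zero_add] at h1 h2
    -- Only `v_y` is bounded by the second correction; `u_x = q - v_y` follows from the divergence.
    have hux : ∑ i ∈ Ico (0 : ℤ) n, ∑ j ∈ Ico (0 : ℤ) m, (u (i + 1) j - u i j) ^ 2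
        ≤ 2 * Q + 2 * (K * B) := by
      have : ∑ i ∈ Ico (0 : ℤ) n, ∑ j ∈ Ico (0 : ℤ) m, (u (i + 1) j - u i j) ^ 2
          ≤ ∑ i ∈ Ico (0 : ℤ) n, ∑ j ∈ Ico (0 : ℤ) m,
            (2 * p i j ^ 2 + 2 * (v i (j + 1) - v i j) ^ 2) := by
        refine Finset.sum_le_sum fun i hi => Finset.sum_le_sum fun j hj => ?_
        have := hdiv i hi j hj
        rw [show u (i + 1) j - u i j = p i j - (v i (j + 1) - v i j) by linarith]
        nlinarith [sq_nonneg (p i j + (v i (j + 1) - v i j))]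
      simp only [Finset.sum_add_distrib, ← Finset.mul_sum] at this
      linarith
    have huy' := (sum_sum_sq_le (Ioo_subset_Icc_self (a := (0 : ℤ)) (b := n)) (Subset.refl _)
      fun i j => u i j - u i (j - 1)).trans huy
    rw [Finset.sum_comm] at hvx
    have hvx' := (sum_sum_sq_le (Ioo_subset_Icc_self (a := (0 : ℤ)) (b := m)) (Subset.refl _)
      fun j i => v i j - v (i - 1) j).trans hvx
    have m2 := nn (Ioo (0 : ℤ) n) (Ioo (0 : ℤ) m) fun i j => u i j - u i (j - 1)
    have m3 := nn (Ioo (0 : ℤ) n) (Ioo (0 : ℤ) m) fun i j => v i j - v (i - 1) j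
    have : 9 * K * (2 * 10 ^ 9 * (1 + κ ^ 2)) * Q = 9 * (K * B) := by rw [hB]; ring
    rw [this]
    linarith


section

/-! ### The inf-sup constant -/

variable {nx ny : ℕ} {h : ℝ}

lemma div_scale : div nx ny h = h⁻¹ • div nx ny 1 := by
  have e : ∀ n, faceToCell n h = h⁻¹ • faceToCell n 1 := fun n => by
    ext i k
    rw [Matrix.smul_apply]
    simp [faceToCell]
  rw [div, div, e, e, smul_kronecker, kronecker_smul]
  ext i (j | j) <;> rfl

lemma lap_scale : lap nx ny h = (h ^ 2)⁻¹ • lap nx ny 1 := by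
  have e : ∀ n, lapNormal n h = (h ^ 2)⁻¹ • lapNormal n 1 := fun n => by
    ext i k
    rw [Matrix.smul_apply]
    simp [lapNormal]
  have e' : ∀ n, lapTangential n h = (h ^ 2)⁻¹ • lapTangential n 1 := fun n => by
    ext i k
    rw [Matrix.smul_apply]
    simp [lapTangential]
  rw [lap, lap, e, e, e', e']
  simp only [smul_kronecker, kronecker_smul, fromBlocks_smul, smul_zero, smul_add]

/-! ### Bounds for the quotient and positivity of the constant -/

lemma infSupQuotient_le (hh : 0 < h) {q : Cell nx ny → ℝ} (hq : q ≠ 0) {w : Face nx ny → ℝ}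
    (hw : w ≠ 0) {μ : ℝ}
    (hμ : (q ⬝ᵥ div nx ny h *ᵥ w) ^ 2 ≤ μ * (q ⬝ᵥ q) * -(w ⬝ᵥ lap nx ny h *ᵥ w)) :
    infSupQuotient nx ny h q w ≤ √μ := by
  have hE := energy_pos hh.ne' hw
  have hQ := dotProduct_self_pos hq
  have h2 : 0 < h ^ 2 := by positivity
  have hμ0 : 0 ≤ μ := by
    have : 0 ≤ μ * ((q ⬝ᵥ q) * -(w ⬝ᵥ lap nx ny h *ᵥ w)) := by
      rw [← mul_assoc]; exact (sq_nonneg _).trans hμ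
    exact nonneg_of_mul_nonneg_left this (mul_pos hQ hE)
  rw [infSupQuotient, div_le_iff₀ (mul_pos (Real.sqrt_pos.mpr (mul_pos h2 hQ))
    (Real.sqrt_pos.mpr (mul_pos h2 hE))), ← Real.sqrt_mul (mul_pos h2 hQ).le, ← Real.sqrt_mul hμ0]
  refine Real.le_sqrt_of_sq_le ?_
  calc (h ^ 2 * (q ⬝ᵥ div nx ny h *ᵥ w)) ^ 2
      = h ^ 2 * h ^ 2 * (q ⬝ᵥ div nx ny h *ᵥ w) ^ 2 := by ring
    _ ≤ h ^ 2 * h ^ 2 * (μ * (q ⬝ᵥ q) * -(w ⬝ᵥ lap nx ny h *ᵥ w)) :=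
        mul_le_mul_of_nonneg_left hμ (by positivity)
    _ = _ := by ring

/-- This makes the family of quotients bounded above, so that its real `⨆` is a true supremum rather
than the default value 0. -/
lemma infSupQuotient_le_one (hh : 0 < h) {q : Cell nx ny → ℝ} (hq : q ≠ 0) {w : Face nx ny → ℝ}
    (hw : w ≠ 0) : infSupQuotient nx ny h q w ≤ 1 := by
  rw [← Real.sqrt_one]
  refine infSupQuotient_le hh hq hw ?_
  have h1 : (q ⬝ᵥ div nx ny h *ᵥ w) ^ 2
      ≤ (q ⬝ᵥ q) * ((div nx ny h *ᵥ w) ⬝ᵥ (div nx ny h *ᵥ w)) := by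
    simpa [dotProduct, pow_two] using
      Finset.sum_mul_sq_le_sq_mul_sq Finset.univ q (div nx ny h *ᵥ w)
  rw [one_mul]
  exact h1.trans (mul_le_mul_of_nonneg_left (div_sq_le_energy nx ny h w)
    (dotProduct_self_pos hq).le)

lemma le_infSupQuotient {C : ℝ} (hC : 0 < C) (hh : 0 < h) {q : Cell nx ny → ℝ} (hq : q ≠ 0)
    {w : Face nx ny → ℝ} (hw : w ≠ 0) (hD : div nx ny h *ᵥ w = q)
    (hE : -(w ⬝ᵥ lap nx ny h *ᵥ w) ≤ C * (q ⬝ᵥ q)) :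
    1 / √C ≤ infSupQuotient nx ny h q w := by
  have hE0 := energy_pos hh.ne' hw
  have hQ := dotProduct_self_pos hq
  have h2 : 0 < h ^ 2 := by positivity
  rw [infSupQuotient, hD, div_le_div_iff₀ (Real.sqrt_pos.mpr hC)
    (mul_pos (Real.sqrt_pos.mpr (mul_pos h2 hQ)) (Real.sqrt_pos.mpr (mul_pos h2 hE0))), one_mul]
  have h3 : √(h ^ 2 * -(w ⬝ᵥ lap nx ny h *ᵥ w)) ≤ √C * √(h ^ 2 * (q ⬝ᵥ q)) := by
    rw [← Real.sqrt_mul hC.le]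
    refine Real.sqrt_le_sqrt ?_
    nlinarith
  calc √(h ^ 2 * (q ⬝ᵥ q)) * √(h ^ 2 * -(w ⬝ᵥ lap nx ny h *ᵥ w))
      ≤ √(h ^ 2 * (q ⬝ᵥ q)) * (√C * √(h ^ 2 * (q ⬝ᵥ q))) :=
        mul_le_mul_of_nonneg_left h3 (Real.sqrt_nonneg _)
    _ = √(h ^ 2 * (q ⬝ᵥ q)) * √(h ^ 2 * (q ⬝ᵥ q)) * √C := by ring
    _ = _ := by rw [Real.mul_self_sqrt (mul_pos h2 hQ).le]

/-- The discrete inf-sup condition, uniformly over the grids of a rectangle. -/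
theorem exists_uniform_infSup {a b : ℝ} (ha : 0 < a) (hb : 0 < b) : ∃ β : ℝ, 0 < β ∧
    ∀ (nx ny : ℕ) (h : ℝ), IsGrid a b nx ny h → ∀ q : Cell nx ny → ℝ, q ≠ 0 → ∑ c, q c = 0 →
      β ≤ ⨆ w : {w : Face nx ny → ℝ // w ≠ 0}, infSupQuotient nx ny h q w := by
  -- All grids satisfy `nx / ny = a / b`, so one aspect bound `κ` serves for all of them.
  obtain ⟨C, hC, hw⟩ := exists_right_inverse (a / b + b / a)
  refine ⟨1 / √C, by positivity, ?_⟩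
  rintro nx ny h ⟨hx, hy, hh, hxa, hyb⟩ q hq hq0
  have hab : 0 < a / b := by positivity
  have hba : 0 < b / a := by positivity
  have hnx : (nx : ℝ) = a / b * ny := by rw [← hxa, ← hyb]; field_simp
  have hny : (ny : ℝ) = b / a * nx := by rw [← hxa, ← hyb]; field_simp
  have hx0 : (0 : ℝ) ≤ nx := by positivity
  have hy0 : (0 : ℝ) ≤ ny := by positivity
  obtain ⟨w, hD, hE⟩ := hw nx ny hx hy
    (by rw [add_mul, ← hnx]; nlinarith) (by rw [add_mul, ← hny]; nlinarith) q hq0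
  -- Passing from unit cells to side `h`, the factor `h` restores the divergence and leaves the
  -- energy unchanged.
  have hD' : div nx ny h *ᵥ (h • w) = q := by
    rw [div_scale, smul_mulVec, mulVec_smul, hD, smul_smul, inv_mul_cancel₀ hh.ne', one_smul]
  have hE' : -((h • w) ⬝ᵥ lap nx ny h *ᵥ (h • w)) ≤ C * (q ⬝ᵥ q) := by
    have : (h • w) ⬝ᵥ lap nx ny h *ᵥ (h • w) = w ⬝ᵥ lap nx ny 1 *ᵥ w := by
      rw [lap_scale, smul_mulVec, mulVec_smul, smul_dotProduct, dotProduct_smul, dotProduct_smul]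
      simp only [smul_eq_mul]
      field_simp
    rw [this]; exact hE
  have hw0 : h • w ≠ 0 := by
    intro h0
    rw [h0, mulVec_zero] at hD'
    exact hq hD'.symm
  refine (le_infSupQuotient hC hh hq hw0 hD' hE').trans
    (le_ciSup (f := fun w : {w : Face nx ny → ℝ // w ≠ 0} => infSupQuotient nx ny h q w) ?_
      ⟨h • w, hw0⟩)
  exact ⟨1, by rintro _ ⟨w, rfl⟩; exact infSupQuotient_le_one hh hq w.2⟩

lemma infSup_pos {a b : ℝ} (hab : ∃ (nx ny : ℕ) (h : ℝ), IsGrid a b nx ny h) :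
    0 < infSup a b := by
  obtain ⟨nx, ny, h, hx, hy, hh, rfl, rfl⟩ := hab
  have hx' : (0 : ℝ) < nx := by exact_mod_cast hx
  have hy' : (0 : ℝ) < ny := by exact_mod_cast hy
  obtain ⟨β, hβ, hinf⟩ := exists_uniform_infSup (mul_pos hx' hh) (mul_pos hy' hh)
  refine hβ.trans_le (le_csInf ?_ ?_)
  -- The infimum of the empty set would be 0. The given grid may have a single cell and hence no
  -- admissible `q`, so a halved grid supplies one.
  · let c₀ : Cell (2 * nx) (2 * ny) := (⟨0, by omega⟩, ⟨0, by omega⟩)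
    let c₁ : Cell (2 * nx) (2 * ny) := (⟨1, by omega⟩, ⟨0, by omega⟩)
    have hne : c₀ ≠ c₁ := by simp [c₀, c₁]
    refine ⟨_, 2 * nx, 2 * ny, h / 2, ⟨by omega, by omega, by positivity, ?_, ?_⟩,
      Pi.single c₀ 1 - Pi.single c₁ 1, ?_, ?_, rfl⟩
    · push_cast; ring
    · push_cast; ring
    · intro h0
      have := congrFun h0 c₀
      simp [hne] at this
    · simp [Finset.sum_sub_distrib]
  · rintro r ⟨nx', ny', h', hg, q, hq, hq0, rfl⟩
    exact hinf nx' ny' h' hg q hq hq0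

/-- The eigenvector itself is an admissible pressure, and all its quotients are at most `√μ`. -/
lemma infSup_sq_le {a b : ℝ} (hg : IsGrid a b nx ny h) {q : Cell nx ny → ℝ} {μ : ℝ} (hq : q ≠ 0)
    (hq0 : ∑ c, q c = 0) (hS : schur nx ny h *ᵥ q = μ • q) : infSup a b ^ 2 ≤ μ := by
  have hh := hg.2.2.1
  have hμ := (eigenvalue_mem hh.ne' hq hS).1
  rw [← Real.le_sqrt (infSup_pos ⟨nx, ny, h, hg⟩).le hμ]
  rw [infSup]
  refine le_trans (csInf_le ?_ ⟨nx, ny, h, hg, q, hq, hq0, rfl⟩) ?_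
  -- The uniform bound also shows that the infimum is over a set bounded below.
  · obtain ⟨hx, hy, hh, rfl, rfl⟩ := hg
    obtain ⟨β, -, hinf⟩ := exists_uniform_infSup (a := nx * h) (b := ny * h) (by positivity)
      (by positivity)
    refine ⟨β, ?_⟩
    rintro r ⟨nx', ny', h', hg, q, hq, hq0, rfl⟩
    exact hinf nx' ny' h' hg q hq hq0
  · exact Real.iSup_le (fun w => infSupQuotient_le hh hq w.2 (eigenvalue_bound hh.ne' hS w))
      (Real.sqrt_nonneg _)

end

end MAC

theorem mainTheorem4 (a b : ℝ)
    (hab : ∃ (nx ny : ℕ) (h : ℝ), MAC.IsGrid a b nx ny h) :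
    0 < MAC.infSup a b ∧
    ∀ (nx ny : ℕ) (h : ℝ), MAC.IsGrid a b nx ny h →
      IsUnit (MAC.lap nx ny h).det ∧
      spectrum ℂ (MAC.schurC nx ny h) ⊆
        (fun x : ℝ => (x : ℂ)) '' ({0} ∪ Set.Icc ((MAC.infSup a b) ^ 2) 1) ∧
      (MAC.schurC nx ny h).charpoly.roots.count 0 = 1 ∧
      (2 ≤ nx * ny →
        ((MAC.schurC nx ny h).charpoly.roots.filter (fun z => z ≠ 1)).card
          ≤ 2 * (nx - 1) + 2 * (ny - 1)) := by
  refine ⟨MAC.infSup_pos hab, fun nx ny h hg => ?_⟩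
  obtain ⟨hx, hy, hh, -, -⟩ := id hg
  exact ⟨MAC.isUnit_det_lap hh.ne',
    MAC.spectrum_schurC_subset hh.ne' fun q μ hq hq0 hS => MAC.infSup_sq_le hg hq hq0 hS,
    MAC.count_zero_roots_schurC hx hy hh.ne', MAC.card_roots_schurC_ne_one hx hy hh.ne'⟩
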